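/- **Setting.** For $k\in\mathbb Z$ let $\mathcal M_k$ be the space of holomorphic functions on the upper half-plane $\mathbb H$ that are modular forms of weight $k$ (holomorphic at the cusps) for some principal congruence subgroup $\Gamma(N)$, $N\ge 1$, and let $\mathcal M=\bigoplus_{k\in\mathbb Z}\mathcal M_k$ be the graded algebra of modular forms of all levels, with the pointwise product. The group $\mathrm{GL}^+(2,\mathbb Q)$ acts on the right on $\mathcal M$ by $$(f|\gamma)(z)=\det(\gamma)^{k/2}(cz+d)^{-k}f(\gamma z),\qquad f\in\mathcal M_k,\ \gamma=\begin{pmatrix}a&b\\c&d\end{pmatrix}.$$ Let $\mathcal A=\mathcal M\rtimes\mathrm{GL}^+(2,\mathbb Q)$ be the crossed product algebra: its elements are the finite sums $\sum_\gamma f_\gamma U_\gamma$ with $f_\gamma\in\mathcal M$, and its product is determined by $(f^0U_\alpha)(f^1U_\beta)=f^0\cdot(f^1|\alpha^{-1})\,U_{\alpha\beta}$. Write $U_\gamma^*=U_{\gamma^{-1}}$. Let $\mathcal H_1$ be the Hopf algebra which, as an algebra, is the universal enveloping algebra of the complex Lie algebra with basis $X$, $Y$, $\delta_n$ $(n\ge1)$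 and brackets $[Y,X]=X$, $[Y,\delta_n]=n\delta_n$, $[X,\delta_n]=\delta_{n+1}$, $[\delta_k,\delta_l]=0$, with the multiplicative coproduct determined by $\Delta Y=Y\otimes1+1\otimes Y$, $\Delta\delta_1=\delta_1\otimes1+1\otimes\delta_1$, $\Delta X=X\otimes1+1\otimes X+\delta_1\otimes Y$. Let $\delta:\mathcal H_1\to\mathbb C$ be the character with $\delta(Y)=1$, $\delta(X)=\delta(\delta_n)=0$. The standard action of $\mathcal H_1$ on $\mathcal A$ is the Hopf action determined, for $f\in\mathcal M_k$ and $\gamma\in\mathrm{GL}^+(2,\mathbb Q)$, by $$Y(fU_\gamma^*)=\tfrac k2\,fU_\gamma^*,\qquad X(fU_\gamma^*)=\frac1{2\pi i}\Big(\frac{df}{dz}-\frac{d\log\eta^4}{dz}\cdot\frac k2 f\Big)U_\gamma^*,\qquad \delta_1(fU_\gamma^*)=\mu_\gamma f\,U_\gamma^*,$$ where $\eta$ is the Dedekind function, $\Delta=\eta^{24}$ and $\mu_\gamma=\frac1{12\pi i}\frac{d}{dz}\log\frac{\Delta|\gamma}{\Delta}\in\mathcal M_2$. Fix $z_0\in\mathbb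 H$. Let $\tau_0:\mathcal A\times\mathcal A\to\mathbb C$ be the bilinear form whose value on $f^0U_{\gamma_0}$, $f^1U_{\gamma_1}$, with $f^0$, $f^1$ homogeneous of weights $w(f^0)$, $w(f^1)$, is $$\tau_0(f^0U_{\gamma_0},f^1U_{\gamma_1})=\int_{z_0}^{\gamma_0z_0}f^0\cdot(f^1|\gamma_1)\,dz\quad\text{if }w(f^0)+w(f^1)=2\text{ and }\gamma_0\gamma_1=1,$$ and $0$ otherwise. **Proposition.** For every $z_0\in\mathbb H$: 1. $\tau_0$ is a cyclic $1$-cocycle on $\mathcal A$: for all $a^0,a^1,a^2\in\mathcal A$ one has $\tau_0(a^0,a^1)=-\tau_0(a^1,a^0)$ and $\tau_0(a^0a^1,a^2)-\tau_0(a^0,a^1a^2)+\tau_0(a^2a^0,a^1)=0$. 2. $\tau_0$ is $\delta$-invariant under the standard action: $\sum\tau_0(h_{(1)}(a^0),h_{(2)}(a^1))=\delta(h)\,\tau_0(a^0,a^1)$ for all $h\in\mathcal H_1$ and $a^0,a^1\in\mathcal A$, where $\Delta h=\sum h_{(1)}\otimes h_{(2)}$. -/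

import Mathlib

open UpperHalfPlane hiding I
open Complex
open scoped MatrixGroups ModularForm Manifold Derivative TensorProduct DirectSum

noncomputable section

namespace ModularSymbol

/-! ### Modular forms of all levels -/

/-- The inclusion of `GL⁺(2, ℚ)` into `GL(2, ℝ)`. -/
def toGLReal : GL(2, ℚ)⁺ →* GL (Fin 2) ℝ :=
  (Matrix.GeneralLinearGroup.map (Rat.castHom ℝ)).comp (Subgroup.subtype _)

theorem toGLReal_det_pos (γ : GL(2, ℚ)⁺) : 0 < (toGLReal γ).det.val := by
  have h : (0 : ℚ) < (γ : GL (Fin 2) ℚ).det.val := γ.2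
  have : (toGLReal γ).det.val = (((γ : GL (Fin 2) ℚ).det.val : ℚ) : ℝ) := by
    simp [toGLReal, Matrix.det_fin_two]
  rw [this]; exact_mod_cast h

/-- `f` is a (holomorphic) modular form of weight `k` for some principal congruence subgroup. -/
def IsModular (k : ℤ) (f : ℍ → ℂ) : Prop :=
  ∃ N : ℕ, N ≠ 0 ∧
    ∃ F : ModularForm ((CongruenceSubgroup.Gamma N).map (Matrix.SpecialLinearGroup.mapGL ℝ)) k,
      (F : ℍ → ℂ) = f

theorem IsModular.mdiff {k : ℤ} {f : ℍ → ℂ} (h : IsModular k f) : MDiff f := by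
  obtain ⟨N, -, F, rfl⟩ := h
  exact F.holo'

theorem IsModular.bdd {k : ℤ} {f : ℍ → ℂ} (h : IsModular k f) (g : SL(2, ℤ)) :
    IsBoundedAtImInfty (f ∣[k] g) := by
  obtain ⟨N, hN, F, rfl⟩ := h
  have : NeZero N := ⟨hN⟩
  exact ModularFormClass.bdd_at_infty_slash F g

theorem IsModular.inv {k : ℤ} {f : ℍ → ℂ} (h : IsModular k f) :
    ∃ N : ℕ, N ≠ 0 ∧ ∀ g ∈ CongruenceSubgroup.Gamma N, f ∣[k] g = f := by
  obtain ⟨N, hN, F, rfl⟩ := h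
  exact ⟨N, hN, fun g hg ↦ F.slash_action_eq' _ (Subgroup.mem_map_of_mem _ hg)⟩

theorem isModular_of {k : ℤ} {f : ℍ → ℂ} (hf : MDiff f)
    (hinv : ∃ N : ℕ, N ≠ 0 ∧ ∀ g ∈ CongruenceSubgroup.Gamma N, f ∣[k] g = f)
    (hb : ∀ g : SL(2, ℤ), IsBoundedAtImInfty (f ∣[k] g)) : IsModular k f := by
  obtain ⟨N, hN, hinv⟩ := hinv
  have : NeZero N := ⟨hN⟩
  refine ⟨N, hN, ⟨⟨f, ?_⟩, hf, ?_⟩, rfl⟩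
  · rintro _ ⟨g, hg, rfl⟩
    exact hinv g hg
  · intro c hc
    rw [Subgroup.IsArithmetic.isCusp_iff_isCusp_SL2Z] at hc
    exact (OnePoint.isBoundedAt_iff_forall_SL2Z hc).mpr fun γ _ ↦ hb γ

theorem gamma_of_dvd {N M : ℕ} (h : N ∣ M) {g : SL(2, ℤ)}
    (hg : g ∈ CongruenceSubgroup.Gamma M) : g ∈ CongruenceSubgroup.Gamma N := by
  rw [CongruenceSubgroup.Gamma_mem] at hg ⊢
  obtain ⟨h1, h2, h3, h4⟩ := hg
  have c {a : ℤ} {b : ZMod M} (hab : (a : ZMod M) = b) : (a : ZMod N) = ZMod.castHom h _ b := by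
    rw [← hab, map_intCast]
  exact ⟨(c h1).trans (map_one _), (c h2).trans (map_zero _), (c h3).trans (map_zero _),
    (c h4).trans (map_one _)⟩

theorem IsModular.add {k : ℤ} {f g : ℍ → ℂ} (hf : IsModular k f) (hg : IsModular k g) :
    IsModular k (f + g) := by
  obtain ⟨N, hN, hN'⟩ := hf.inv
  obtain ⟨M, hM, hM'⟩ := hg.inv
  refine isModular_of (hf.mdiff.add hg.mdiff) ⟨N * M, mul_ne_zero hN hM, fun γ hγ ↦ ?_⟩ fun γ ↦ ?_
  · rw [SlashAction.add_slash, hN' γ (gamma_of_dvd (dvd_mul_right _ _) hγ),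
      hM' γ (gamma_of_dvd (dvd_mul_left _ _) hγ)]
  · rw [SlashAction.add_slash]
    exact (hf.bdd γ).add (hg.bdd γ)

theorem IsModular.mul {k l : ℤ} {f g : ℍ → ℂ} (hf : IsModular k f) (hg : IsModular l g) :
    IsModular (k + l) (f * g) := by
  obtain ⟨N, hN, hN'⟩ := hf.inv
  obtain ⟨M, hM, hM'⟩ := hg.inv
  refine isModular_of (hf.mdiff.mul hg.mdiff) ⟨N * M, mul_ne_zero hN hM, fun γ hγ ↦ ?_⟩ fun γ ↦ ?_
  · rw [ModularForm.mul_slash_SL2, hN' γ (gamma_of_dvd (dvd_mul_right _ _) hγ),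
      hM' γ (gamma_of_dvd (dvd_mul_left _ _) hγ)]
  · rw [ModularForm.mul_slash_SL2]
    exact (hf.bdd γ).mul (hg.bdd γ)

theorem isModular_const (c : ℂ) : IsModular 0 (fun _ ↦ c) := by
  refine isModular_of mdifferentiable_const ⟨1, one_ne_zero, fun γ _ ↦ ?_⟩ fun γ ↦ ?_
  · exact ModularForm.is_invariant_const γ c
  · rw [show ((fun _ ↦ c : ℍ → ℂ) ∣[(0 : ℤ)] γ) = _ from ModularForm.is_invariant_const γ c]
    exact Filter.const_boundedAtFilter _ c

theorem IsModular.smul {k : ℤ} {f : ℍ → ℂ} (c : ℂ) (hf : IsModular k f) :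
    IsModular k (c • f) := by
  have := (isModular_const c).mul hf
  rw [zero_add] at this
  exact this

theorem isModular_zero (k : ℤ) : IsModular k 0 :=
  ⟨1, one_ne_zero, 0, rfl⟩

/-- The space `ℳ_k` of modular forms of weight `k` and of all levels. -/
def formsOfWeight (k : ℤ) : Submodule ℂ (ℍ → ℂ) where
  carrier := {f | IsModular k f}
  add_mem' := IsModular.add
  zero_mem' := isModular_zero k
  smul_mem' c _ := IsModular.smul c

theorem mem_formsOfWeight {k : ℤ} {f : ℍ → ℂ} : f ∈ formsOfWeight k ↔ IsModular k f := Iff.rfl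

instance : SetLike.GradedMonoid formsOfWeight where
  one_mem := isModular_const 1
  mul_mem _ _ _ _ := IsModular.mul

/-- The graded algebra `ℳ = ⨁ ℳ_k` of modular forms of all levels, with pointwise product. -/
def FormAlgebra : Type := ⨁ k : ℤ, formsOfWeight k

instance : CommRing FormAlgebra := inferInstanceAs (CommRing (⨁ k : ℤ, formsOfWeight k))

instance : Algebra ℂ FormAlgebra := inferInstanceAs (Algebra ℂ (⨁ k : ℤ, formsOfWeight k))

/-- A modular form of weight `k`, as a homogeneous element of `ℳ`. -/
def form (k : ℤ) : formsOfWeight k →ₗ[ℂ] FormAlgebra :=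
  DirectSum.lof ℂ ℤ (fun k ↦ formsOfWeight k) k

/-- The component of weight `k` of an element of `ℳ`. -/
def component (k : ℤ) : FormAlgebra →ₗ[ℂ] formsOfWeight k :=
  DirectSum.component ℂ ℤ (fun k ↦ formsOfWeight k) k

/-- The linear map on `ℳ` with given values on the forms of each weight. -/
def liftForm {M : Type*} [AddCommGroup M] [Module ℂ M] (φ : ∀ k : ℤ, formsOfWeight k →ₗ[ℂ] M) :
    FormAlgebra →ₗ[ℂ] M :=
  DirectSum.toModule ℂ ℤ M φ

theorem liftForm_form {M : Type*} [AddCommGroup M] [Module ℂ M]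
    (φ : ∀ k : ℤ, formsOfWeight k →ₗ[ℂ] M) (k : ℤ) (f : formsOfWeight k) :
    liftForm φ (form k f) = φ k f :=
  DirectSum.toModule_lof ℂ (φ := φ) k f

theorem form_induction {p : FormAlgebra → Prop} (x : FormAlgebra) (h0 : p 0)
    (hf : ∀ k f, p (form k f)) (ha : ∀ x y, p x → p y → p (x + y)) : p x :=
  DirectSum.induction_on x h0 hf ha

theorem form_mul_form {k l : ℤ} (f : formsOfWeight k) (g : formsOfWeight l) :
    form k f * form l g = form (k + l) ⟨(f : ℍ → ℂ) * g, IsModular.mul f.2 g.2⟩ :=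
  DirectSum.of_mul_of (A := fun k ↦ formsOfWeight k) _ _

theorem form_one : form 0 ⟨1, isModular_const 1⟩ = 1 := rfl

theorem form_congr {k l : ℤ} (h : k = l) {f : formsOfWeight k} {g : formsOfWeight l}
    (hfg : (f : ℍ → ℂ) = g) : form k f = form l g := by
  subst h
  rw [Subtype.ext hfg]

/-! ### The slash action of `GL⁺(2, ℚ)` -/

/-- The weight `k` action `(f | γ)(z) = det(γ)^{k/2} (c z + d)^{-k} f(γ z)`. -/
def slash (k : ℤ) (γ : GL(2, ℚ)⁺) (f : ℍ → ℂ) (z : ℍ) : ℂ :=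
  (√((toGLReal γ).det.val) : ℂ) ^ k * denom (toGLReal γ) z ^ (-k) * f (toGLReal γ • z)

theorem sqrt_det_ne_zero (γ : GL(2, ℚ)⁺) : ((√((toGLReal γ).det.val) : ℝ) : ℂ) ≠ 0 :=
  ofReal_ne_zero.mpr (Real.sqrt_pos.mpr (toGLReal_det_pos γ)).ne'

/-- The ratio between the normalization of `slash` and that of `SlashAction`. -/
def slashFactor (k : ℤ) (γ : GL(2, ℚ)⁺) : ℂ :=
  (√((toGLReal γ).det.val) : ℂ) ^ k * ((toGLReal γ).det.val : ℂ) ^ (1 - k)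

theorem slash_eq (k : ℤ) (γ : GL(2, ℚ)⁺) (f : ℍ → ℂ) :
    slash k γ f = slashFactor k γ • (f ∣[k] toGLReal γ) := by
  ext z
  have h := toGLReal_det_pos γ
  have h' : ((toGLReal γ).det.val : ℂ) ≠ 0 := ofReal_ne_zero.mpr h.ne'
  simp only [slash, Pi.smul_apply, smul_eq_mul, slashFactor, ModularForm.slash_apply,
    UpperHalfPlane.σ, if_pos h, abs_of_pos h]
  have hk := zpow_ne_zero (k - 1) h'
  rw [show (1 - k : ℤ) = -(k - 1) by ring,
    zpow_neg ((toGLReal γ).det.val : ℂ) (k - 1)]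
  simp only [ContinuousAlgEquiv.refl_apply]
  generalize ((toGLReal γ).det.val : ℂ) ^ (k - 1) = d at hk
  field_simp

theorem slash_one (k : ℤ) (f : ℍ → ℂ) : slash k 1 f = f := by
  rw [slash_eq, map_one, SlashAction.slash_one]
  simp [slashFactor]

theorem slash_mul (k : ℤ) (α β : GL(2, ℚ)⁺) (f : ℍ → ℂ) :
    slash k (α * β) f = slash k β (slash k α f) := by
  have hf : slashFactor k (α * β) = slashFactor k β * slashFactor k α := by
    simp only [slashFactor, map_mul, Units.val_mul]
    rw [Real.sqrt_mul (toGLReal_det_pos α).le, ofReal_mul, ofReal_mul, mul_zpow, mul_zpow]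
    ring
  have hσ : UpperHalfPlane.σ (toGLReal β) = ContinuousAlgEquiv.refl ℝ ℂ := by
    simp only [UpperHalfPlane.σ, if_pos (toGLReal_det_pos β)]
  rw [slash_eq, slash_eq, slash_eq, map_mul, SlashAction.slash_mul, ModularForm.smul_slash,
    hσ, hf, mul_smul]
  rfl

theorem slash_add (k : ℤ) (γ : GL(2, ℚ)⁺) (f g : ℍ → ℂ) :
    slash k γ (f + g) = slash k γ f + slash k γ g := by
  ext z; simp [slash, mul_add]

theorem slash_smul (k : ℤ) (γ : GL(2, ℚ)⁺) (c : ℂ) (f : ℍ → ℂ) :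
    slash k γ (c • f) = c • slash k γ f := by
  ext z; simp only [slash, Pi.smul_apply, smul_eq_mul]; ring

theorem slash_prod (k l : ℤ) (γ : GL(2, ℚ)⁺) (f g : ℍ → ℂ) :
    slash (k + l) γ (f * g) = slash k γ f * slash l γ g := by
  ext z
  simp only [slash, Pi.mul_apply, neg_add, zpow_add₀ (sqrt_det_ne_zero γ),
    zpow_add₀ (denom_ne_zero (toGLReal γ) z)]
  ring

theorem slash_const_one (γ : GL(2, ℚ)⁺) : slash 0 γ 1 = 1 := by
  ext z; simp [slash]

open Matrix.SpecialLinearGroup in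
/-- Every congruence subgroup contains the conjugate of another one by an element of
`GL⁺(2, ℚ)`. -/
theorem exists_gamma_conj (γ : GL(2, ℚ)⁺) (M : ℕ) (hM : M ≠ 0) :
    ∃ N : ℕ, N ≠ 0 ∧ ∀ x ∈ CongruenceSubgroup.Gamma N, ∃ y ∈ CongruenceSubgroup.Gamma M,
      toGLReal γ * mapGL ℝ x = mapGL ℝ y * toGLReal γ := by
  have : NeZero M := ⟨hM⟩
  obtain ⟨N, hN, h⟩ := CongruenceSubgroup.exists_Gamma_le_conj (γ : GL (Fin 2) ℚ) M
  refine ⟨N, hN, fun x hx ↦ ?_⟩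
  obtain ⟨y, hy, hxy⟩ := h x hx
  refine ⟨y, hy, ?_⟩
  have h2 : (γ : GL (Fin 2) ℚ) * mapGL ℚ x = mapGL ℚ y * γ := by
    rw [hxy]; group
  have h3 := congrArg (Matrix.GeneralLinearGroup.map (Rat.castHom ℝ)) h2
  rw [map_mul, map_mul] at h3
  have hm (x : SL(2, ℤ)) :
      Matrix.GeneralLinearGroup.map (Rat.castHom ℝ) (mapGL ℚ x) = mapGL ℝ x := by
    ext i j; simp
  rw [hm, hm] at h3
  exact h3

open Matrix.SpecialLinearGroup in
/-- `GL⁺(2, ℚ) = SL(2, ℤ) · {upper triangular matrices}`. -/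
theorem exists_upper (γ : GL(2, ℚ)⁺) :
    ∃ (g : SL(2, ℤ)) (T : GL(2, ℚ)⁺), toGLReal γ = mapGL ℝ g * toGLReal T ∧
      toGLReal T 1 0 = 0 := by
  obtain ⟨g, hg⟩ := OnePoint.exists_mem_SL2 ℤ ((γ : GL (Fin 2) ℚ) • (OnePoint.infty : OnePoint ℚ))
  have hdet : (mapGL ℚ g) ∈ GL(2, ℚ)⁺ := by
    rw [Matrix.mem_glpos]; simp
  refine ⟨g, ⟨mapGL ℚ g, hdet⟩⁻¹ * γ, ?_, ?_⟩
  · have hm : mapGL ℝ g = toGLReal ⟨mapGL ℚ g, hdet⟩ := by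
      ext i j; simp [toGLReal]
    rw [hm, ← map_mul, mul_inv_cancel_left]
  · have h1 : ((mapGL ℚ g)⁻¹ * (γ : GL (Fin 2) ℚ)) • (OnePoint.infty : OnePoint ℚ)
        = OnePoint.infty := by
      rw [mul_smul, ← hg, inv_smul_smul]
    have h2 := OnePoint.smul_infty_eq_self_iff.mp h1
    have h3 : (toGLReal (⟨mapGL ℚ g, hdet⟩⁻¹ * γ)) 1 0 =
        ((((mapGL ℚ g)⁻¹ * (γ : GL (Fin 2) ℚ)) 1 0 : ℚ) : ℝ) := rfl
    rw [h3, h2, Rat.cast_zero]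

theorem IsModular.slash {k : ℤ} {f : ℍ → ℂ} (hf : IsModular k f) (γ : GL(2, ℚ)⁺) :
    IsModular k (slash k γ f) := by
  rw [slash_eq]
  refine IsModular.smul _ (isModular_of (hf.mdiff.slash k _) ?_ fun g ↦ ?_)
  · obtain ⟨M, hM, hinv⟩ := hf.inv
    obtain ⟨N, hN, h⟩ := exists_gamma_conj γ M hM
    refine ⟨N, hN, fun x hx ↦ ?_⟩
    obtain ⟨y, hy, hxy⟩ := h x hx
    rw [ModularForm.SL_slash]
    erw [← SlashAction.slash_mul, hxy, SlashAction.slash_mul]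
    exact congrArg (· ∣[k] toGLReal γ) (hinv y hy)
  · have hdet : (Matrix.SpecialLinearGroup.mapGL ℚ g) ∈ GL(2, ℚ)⁺ := by
      rw [Matrix.mem_glpos]; simp
    have hm : Matrix.SpecialLinearGroup.mapGL ℝ g =
        toGLReal ⟨Matrix.SpecialLinearGroup.mapGL ℚ g, hdet⟩ := by
      ext i j; simp [toGLReal]
    obtain ⟨g', T, h1, h2⟩ := exists_upper (γ * ⟨Matrix.SpecialLinearGroup.mapGL ℚ g, hdet⟩)
    rw [map_mul, ← hm] at h1
    rw [ModularForm.SL_slash]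
    erw [← SlashAction.slash_mul, h1, SlashAction.slash_mul]
    exact (hf.bdd g').slash k h2


theorem toGLReal_val_det_pos (γ : GL(2, ℚ)⁺) : 0 < (toGLReal γ).val.det := by
  have := toGLReal_det_pos γ
  rwa [Matrix.GeneralLinearGroup.val_det_apply] at this

/-! ### The operators `Y`, `X` and the forms `μ_γ` -/

/-- The Ramanujan connection on forms of weight `k`:
`X f = (2πi)⁻¹ f' - (2πi)⁻¹ (log η⁴)' · (k / 2) f`. -/
def ramanujan (k : ℤ) (f : ℍ → ℂ) (z : ℍ) : ℂ :=
  (2 * Real.pi * I)⁻¹ * deriv (f ∘ ofComplex) z -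
    (2 * Real.pi * I)⁻¹ * logDeriv (fun w : ℂ ↦ ModularForm.eta w ^ 4) z * ((k : ℂ) / 2 * f z)

/-- `μ_γ = (12πi)⁻¹ (d/dz) log ((Δ | γ) / Δ)`. -/
def mu (γ : GL(2, ℚ)⁺) (z : ℍ) : ℂ :=
  (12 * Real.pi * I)⁻¹ *
    logDeriv (fun w : ℂ ↦ slash 12 γ ModularForm.discriminant (ofComplex w) /
      ModularForm.discriminant (ofComplex w)) z

theorem ramanujan_eq (k : ℤ) (f : ℍ → ℂ) :
    ramanujan k f = Derivative.serreDerivative k f := by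
  ext z
  have hd : DifferentiableAt ℂ ModularForm.eta (z : ℂ) :=
    ModularForm.differentiableAt_eta_of_mem_upperHalfPlaneSet z.2
  have hl : logDeriv (fun w : ℂ ↦ ModularForm.eta w ^ 4) z =
      4 * ((Real.pi * I / 12) * EisensteinSeries.E2 z) := by
    rw [← ModularForm.logDeriv_eta_eq_E2, logDeriv_fun_pow hd]
    norm_num
  rw [ramanujan, Derivative.serreDerivative_apply, Derivative.normalizedDerivOfComplex, hl]
  have hpi : (Real.pi : ℂ) ≠ 0 := ofReal_ne_zero.mpr Real.pi_ne_zero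
  field_simp
  ring

theorem mdiff_discriminant : MDiff ModularForm.discriminant :=
  CuspForm.discriminant.holo'

/-- The logarithmic derivative of a slashed function. -/
theorem logD_slash {k : ℤ} {F : ℍ → ℂ} (hF : MDiff F) (hF0 : ∀ z, F z ≠ 0)
    (γ : GL(2, ℚ)⁺) :
    D (F ∣[k] toGLReal γ) / (F ∣[k] toGLReal γ) = ((D F / F) ∣[(2 : ℤ)] toGLReal γ) -
      fun z : ℍ ↦ (k : ℂ) * (2 * Real.pi * I)⁻¹ * (toGLReal γ 1 0 / denom (toGLReal γ) z) := by
  have hdet := toGLReal_val_det_pos γ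
  have h' := toGLReal_det_pos γ
  ext z
  rw [Pi.div_apply, Derivative.normalizedDerivOfComplex_slash hF hdet]
  have hz := denom_ne_zero (toGLReal γ) z
  have hd : ((toGLReal γ).val.det : ℂ) ≠ 0 := ofReal_ne_zero.mpr hdet.ne'
  have hσ (x) : UpperHalfPlane.σ (toGLReal γ) x = x := by
    simp only [UpperHalfPlane.σ, if_pos h', ContinuousAlgEquiv.refl_apply]
  have hFz := hF0 (toGLReal γ • z)
  simp only [Pi.sub_apply, ModularForm.slash_apply, hσ, Pi.div_apply,
    Matrix.GeneralLinearGroup.val_det_apply, abs_of_pos hdet]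
  rw [show k + 2 - 1 = (k - 1) + 2 by ring, show -(k + 2) = -k + -2 by ring,
    zpow_add₀ hd, zpow_add₀ hz]
  have h1 := zpow_ne_zero (k - 1) hd
  have h2 := zpow_ne_zero (-k) hz
  generalize ((toGLReal γ).val.det : ℂ) ^ (k - 1) = A at *
  generalize denom (toGLReal γ) z ^ (-k) = B at *
  rw [show (2 : ℤ) - 1 = 1 by norm_num, zpow_one]
  generalize (2 * Real.pi * I : ℂ)⁻¹ = P
  generalize denom (toGLReal γ) z ^ (-2 : ℤ) = Q
  generalize (toGLReal γ 1 0 : ℂ) / denom (toGLReal γ) z = R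
  generalize ((toGLReal γ).val.det : ℂ) = S at *
  field_simp

theorem slash_discriminant_ne_zero (γ : GL(2, ℚ)⁺) (z : ℍ) :
    (ModularForm.discriminant ∣[(12 : ℤ)] toGLReal γ) z ≠ 0 := by
  have h' := toGLReal_det_pos γ
  have hσ (x) : UpperHalfPlane.σ (toGLReal γ) x = x := by
    simp only [UpperHalfPlane.σ, if_pos h', ContinuousAlgEquiv.refl_apply]
  rw [ModularForm.slash_apply, hσ]
  exact mul_ne_zero (mul_ne_zero (ModularForm.discriminant_ne_zero _)
    (zpow_ne_zero _ (ofReal_ne_zero.mpr (abs_pos.mpr h'.ne').ne')))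
    (zpow_ne_zero _ (denom_ne_zero _ _))

theorem mu_eq (γ : GL(2, ℚ)⁺) :
    mu γ = (6 : ℂ)⁻¹ • (D (ModularForm.discriminant ∣[(12 : ℤ)] toGLReal γ) /
      (ModularForm.discriminant ∣[(12 : ℤ)] toGLReal γ) -
        D ModularForm.discriminant / ModularForm.discriminant) := by
  ext z
  set Δ := ModularForm.discriminant
  set Δ' := Δ ∣[(12 : ℤ)] toGLReal γ with hΔ'
  have h0 : ∀ z, Δ z ≠ 0 := ModularForm.discriminant_ne_zero
  have h0' : ∀ z, Δ' z ≠ 0 := slash_discriminant_ne_zero γ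
  have hd : DifferentiableAt ℂ (Δ ∘ ofComplex) z :=
    UpperHalfPlane.mdifferentiableAt_iff.mp (mdiff_discriminant z)
  have hd' : DifferentiableAt ℂ (Δ' ∘ ofComplex) z := UpperHalfPlane.mdifferentiableAt_iff.mp
    ((mdiff_discriminant.slash 12 (toGLReal γ)) z)
  have hc : slashFactor 12 γ ≠ 0 :=
    mul_ne_zero (zpow_ne_zero _ (sqrt_det_ne_zero γ))
      (zpow_ne_zero _ (ofReal_ne_zero.mpr (toGLReal_det_pos γ).ne'))
  have e : (fun w : ℂ ↦ slash 12 γ Δ (ofComplex w) / Δ (ofComplex w)) =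
      fun w ↦ slashFactor 12 γ * ((Δ' ∘ ofComplex) w / (Δ ∘ ofComplex) w) := by
    ext w
    rw [slash_eq]
    simp only [Pi.smul_apply, smul_eq_mul, Function.comp_apply, hΔ', mul_div_assoc]
  have hpi : (Real.pi : ℂ) ≠ 0 := ofReal_ne_zero.mpr Real.pi_ne_zero
  rw [mu, e, logDeriv_const_mul _ _ hc, logDeriv_div _ (by simpa using h0' z) (by simpa using h0 z)
    hd' hd]
  simp only [logDeriv_apply, Function.comp_apply, ofComplex_apply, Pi.smul_apply, Pi.sub_apply,
    Pi.div_apply, Derivative.normalizedDerivOfComplex, smul_eq_mul]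
  have hz := h0 z
  have hz' := h0' z
  field_simp
  ring

/-- The cocycle property `μ_{αβ} = μ_α | β + μ_β`. -/
theorem mu_mul (α β : GL(2, ℚ)⁺) :
    mu (α * β) = (mu α ∣[(2 : ℤ)] toGLReal β) + mu β := by
  have h := logD_slash (k := 12) mdiff_discriminant ModularForm.discriminant_ne_zero β
  have h2 := logD_slash (k := 12) (mdiff_discriminant.slash 12 (toGLReal α))
    (slash_discriminant_ne_zero α) β
  rw [← SlashAction.slash_mul, ← map_mul] at h2
  have hσ (x) : UpperHalfPlane.σ (toGLReal β) x = x := by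
    simp only [UpperHalfPlane.σ, if_pos (toGLReal_det_pos β), ContinuousAlgEquiv.refl_apply]
  rw [mu_eq, mu_eq, mu_eq, ModularForm.smul_slash, hσ, h, h2, sub_eq_add_neg (D _ / _),
    SlashAction.add_slash, SlashAction.neg_slash, ← smul_add]
  congr 1
  abel

/-- Elements of `SL(2, ℤ)` as elements of `GL⁺(2, ℚ)`. -/
def ofSLZ (g : SL(2, ℤ)) : GL(2, ℚ)⁺ :=
  ⟨Matrix.SpecialLinearGroup.mapGL ℚ g, by rw [Matrix.mem_glpos]; simp⟩

theorem toGLReal_ofSLZ (g : SL(2, ℤ)) :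
    toGLReal (ofSLZ g) = Matrix.SpecialLinearGroup.mapGL ℝ g := by
  ext i j; simp [toGLReal, ofSLZ]

theorem mu_ofSLZ (g : SL(2, ℤ)) : mu (ofSLZ g) = 0 := by
  have : ModularForm.discriminant ∣[(12 : ℤ)] toGLReal (ofSLZ g) = ModularForm.discriminant := by
    rw [toGLReal_ofSLZ]
    exact CuspForm.discriminant.slash_action_eq' _ ⟨g, rfl⟩
  rw [mu_eq, this, sub_self, smul_zero]

theorem toGLReal_injective : Function.Injective toGLReal := by
  intro a b h
  ext i j
  have := congrArg (fun g : GL (Fin 2) ℝ ↦ g i j) h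
  exact Rat.cast_injective (α := ℝ) this

theorem logD_discriminant :
    D ModularForm.discriminant / ModularForm.discriminant = EisensteinSeries.E2 := by
  ext z
  have hd : DifferentiableAt ℂ ModularForm.eta (z : ℂ) :=
    ModularForm.differentiableAt_eta_of_mem_upperHalfPlaneSet z.2
  have e : ModularForm.discriminant ∘ ofComplex =ᶠ[nhds (z : ℂ)]
      fun w ↦ ModularForm.eta w ^ 24 := by
    filter_upwards [isOpen_upperHalfPlaneSet.mem_nhds z.2] with w hw
    simp [ModularForm.discriminant, ofComplex_apply_of_im_pos hw]
  have hl := ModularForm.logDeriv_eta_eq_E2 z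
  rw [logDeriv_apply] at hl
  have h0 := ModularForm.eta_ne_zero z.2
  have hpi : (Real.pi : ℂ) ≠ 0 := ofReal_ne_zero.mpr Real.pi_ne_zero
  rw [div_eq_iff h0] at hl
  rw [Pi.div_apply, Derivative.normalizedDerivOfComplex, e.deriv_eq, deriv_fun_pow hd, hl,
    ModularForm.discriminant]
  field_simp
  norm_num
  ring

theorem isModular_mu (γ : GL(2, ℚ)⁺) : IsModular 2 (mu γ) := by
  have key (g : SL(2, ℤ)) : mu γ ∣[(2 : ℤ)] g = mu (γ * ofSLZ g) := by
    rw [mu_mul, mu_ofSLZ, add_zero, toGLReal_ofSLZ]; rfl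
  refine isModular_of ?_ ?_ fun g ↦ ?_
  · rw [mu_eq, logD_slash mdiff_discriminant ModularForm.discriminant_ne_zero, logD_discriminant]
    rw [← logD_discriminant]
    refine MDifferentiable.const_smul _ (.sub (.sub ?_ ?_) ?_)
    · rw [logD_discriminant]
      exact E2_mdifferentiable.slash 2 _
    · have h1 := (mdifferentiable_denom_zpow (toGLReal γ) (-1)).const_smul
        (((12 : ℤ) : ℂ) * (2 * Real.pi * I)⁻¹ * (toGLReal γ 1 0 : ℂ))
      have e : (fun z : ℍ ↦ ((12 : ℤ) : ℂ) * (2 * Real.pi * I)⁻¹ *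
          (toGLReal γ 1 0 / denom (toGLReal γ) z)) = (((12 : ℤ) : ℂ) * (2 * Real.pi * I)⁻¹ *
            (toGLReal γ 1 0 : ℂ)) • fun z : ℍ ↦ denom (toGLReal γ) z ^ (-1 : ℤ) := by
        ext z
        simp [div_eq_mul_inv, mul_assoc]
      rw [e]
      exact h1
    · rw [logD_discriminant]
      exact E2_mdifferentiable
  · obtain ⟨N, hN, h⟩ := exists_gamma_conj γ 1 one_ne_zero
    refine ⟨N, hN, fun x hx ↦ ?_⟩
    obtain ⟨y, -, hxy⟩ := h x hx
    have : γ * ofSLZ x = ofSLZ y * γ := toGLReal_injective (by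
      rw [map_mul, map_mul, toGLReal_ofSLZ, toGLReal_ofSLZ, hxy])
    rw [key, this, mu_mul, mu_ofSLZ, SlashAction.zero_slash, zero_add]
  · obtain ⟨g', T, h1, h2⟩ := exists_upper (γ * ofSLZ g)
    have : γ * ofSLZ g = ofSLZ g' * T := toGLReal_injective (by
      rw [h1, map_mul, toGLReal_ofSLZ])
    rw [key, this, mu_mul, mu_ofSLZ, SlashAction.zero_slash, zero_add, mu_eq,
      logD_slash mdiff_discriminant ModularForm.discriminant_ne_zero, logD_discriminant, h2]
    have hE := EisensteinSeries.isBoundedAtImInfty_E2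
    simp only [ofReal_zero, zero_div, mul_zero]
    have h3 : Filter.BoundedAtFilter atImInfty (fun _ : ℍ ↦ (0 : ℂ)) :=
      Filter.const_boundedAtFilter _ 0
    exact Filter.BoundedAtFilter.smul (6 : ℂ)⁻¹ (((hE.slash 2 h2).sub h3).sub hE)

theorem isBounded_deriv {f : ℍ → ℂ} (hf : MDiff f) (hb : IsBoundedAtImInfty f) :
    IsBoundedAtImInfty (D f) := by
  rw [isBoundedAtImInfty_iff] at hb ⊢
  obtain ⟨M, A, h⟩ := hb
  refine ⟨‖(2 * Real.pi * I : ℂ)⁻¹‖ * (M / 1), max A 0 + 2, fun z hz ↦ ?_⟩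
  rw [Derivative.normalizedDerivOfComplex, norm_mul]
  have him (w : ℂ) (hw : w ∈ Metric.closedBall (z : ℂ) 1) : max A 0 + 1 ≤ w.im := by
    have h1 := (abs_im_le_norm (w - z)).trans (mem_closedBall_iff_norm.mp hw)
    rw [sub_im] at h1
    have h2 := (abs_le.mp h1).1
    have h3 : (z : ℂ).im = z.im := rfl
    linarith
  refine mul_le_mul_of_nonneg_left ?_ (norm_nonneg _)
  refine norm_deriv_le_of_forall_mem_sphere_norm_le one_pos ?_ fun w hw ↦ ?_
  · refine (UpperHalfPlane.mdifferentiable_iff.mp hf).diffContOnCl_ball fun w hw ↦ ?_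
    have := him w hw
    have := le_max_right A 0
    change 0 < w.im
    linarith
  · have := him w (Metric.sphere_subset_closedBall hw)
    have h0 : 0 < w.im := by have := le_max_right A 0; linarith
    rw [Function.comp_apply, ofComplex_apply_of_im_pos h0]
    refine h _ ?_
    have := le_max_left A 0
    change A ≤ w.im
    linarith

theorem IsModular.ramanujan {k : ℤ} {f : ℍ → ℂ} (hf : IsModular k f) :
    IsModular (k + 2) (ramanujan k f) := by
  rw [ramanujan_eq]
  refine isModular_of (Derivative.serreDerivative_mdifferentiable _ hf.mdiff) ?_ fun g ↦ ?_
  · obtain ⟨N, hN, h⟩ := hf.inv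
    exact ⟨N, hN, fun g hg ↦ Derivative.serreDerivative_slash_invariant hf.mdiff (h g hg)⟩
  · rw [Derivative.serreDerivative_slash_equivariant hf.mdiff]
    refine (isBounded_deriv (hf.mdiff.slash k _) (hf.bdd g)).sub ?_
    exact ((Filter.const_boundedAtFilter _ _).mul EisensteinSeries.isBoundedAtImInfty_E2).mul
      (hf.bdd g)


/-! ### The action of `GL⁺(2, ℚ)` on `ℳ`, and the crossed product -/

/-- `f ↦ f | γ` on forms of weight `k`. -/
def slashForm (k : ℤ) (γ : GL(2, ℚ)⁺) : formsOfWeight k →ₗ[ℂ] formsOfWeight k where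
  toFun f := ⟨slash k γ f, f.2.slash γ⟩
  map_add' f g := Subtype.ext (slash_add k γ f g)
  map_smul' c f := Subtype.ext (slash_smul k γ c f)

/-- `f ↦ f | γ` on `ℳ`, the weight `k` action on each `ℳ_k`. -/
def slashLin (γ : GL(2, ℚ)⁺) : FormAlgebra →ₗ[ℂ] FormAlgebra :=
  liftForm fun k ↦ form k ∘ₗ slashForm k γ

theorem slashLin_form (γ : GL(2, ℚ)⁺) (k : ℤ) (f : formsOfWeight k) :
    slashLin γ (form k f) = form k (slashForm k γ f) :=
  liftForm_form _ k f

theorem slashLin_map_one (γ : GL(2, ℚ)⁺) : slashLin γ 1 = 1 := by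
  rw [← form_one, slashLin_form]
  exact form_congr rfl (slash_const_one γ)

theorem slashLin_map_mul (γ : GL(2, ℚ)⁺) (x y : FormAlgebra) :
    slashLin γ (x * y) = slashLin γ x * slashLin γ y := by
  induction x using form_induction with
  | h0 => simp
  | ha a b h1 h2 => simp only [add_mul, map_add, h1, h2]
  | hf k f =>
    induction y using form_induction with
    | h0 => simp
    | ha a b h1 h2 => simp only [mul_add, map_add, h1, h2]
    | hf l g =>
      rw [form_mul_form, slashLin_form, slashLin_form, slashLin_form, form_mul_form]
      exact form_congr rfl (slash_prod k l γ f g)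

theorem slashLin_one (x : FormAlgebra) : slashLin 1 x = x := by
  induction x using form_induction with
  | h0 => simp
  | ha a b h1 h2 => simp only [map_add, h1, h2]
  | hf k f =>
    rw [slashLin_form]
    exact form_congr rfl (slash_one k f)

theorem slashLin_mul (α β : GL(2, ℚ)⁺) (x : FormAlgebra) :
    slashLin (α * β) x = slashLin β (slashLin α x) := by
  induction x using form_induction with
  | h0 => simp
  | ha a b h1 h2 => simp only [map_add, h1, h2]
  | hf k f =>
    rw [slashLin_form, slashLin_form, slashLin_form]
    exact form_congr rfl (slash_mul k α β f)

/-- The left action `γ • f = f | γ⁻¹` of `GL⁺(2, ℚ)` on `ℳ`. -/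
instance : MulSemiringAction GL(2, ℚ)⁺ FormAlgebra where
  smul γ f := slashLin γ⁻¹ f
  one_smul f := by
    change slashLin 1⁻¹ f = f
    rw [inv_one, slashLin_one]
  mul_smul α β f := by
    change slashLin (α * β)⁻¹ f = slashLin α⁻¹ (slashLin β⁻¹ f)
    rw [mul_inv_rev, slashLin_mul]
  smul_zero γ := map_zero (slashLin γ⁻¹)
  smul_add γ := map_add (slashLin γ⁻¹)
  smul_one γ := slashLin_map_one γ⁻¹
  smul_mul γ := slashLin_map_mul γ⁻¹

theorem smul_def (γ : GL(2, ℚ)⁺) (f : FormAlgebra) : γ • f = slashLin γ⁻¹ f := rfl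

/-- The crossed product `𝒜 = ℳ ⋊ GL⁺(2, ℚ)`: finite sums `∑ f_γ U_γ` with
`(f U_α) (g U_β) = f · (g | α⁻¹) U_{αβ}`. -/
abbrev CrossedProduct : Type := SkewMonoidAlgebra FormAlgebra GL(2, ℚ)⁺

/-- The monomial `f U_γ`. -/
abbrev mono (f : FormAlgebra) (γ : GL(2, ℚ)⁺) : CrossedProduct := SkewMonoidAlgebra.single γ f

theorem mono_mul_mono (f g : FormAlgebra) (α β : GL(2, ℚ)⁺) :
    mono f α * mono g β = mono (f * slashLin α⁻¹ g) (α * β) :=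
  SkewMonoidAlgebra.single_mul_single

/-! ### The operators of the standard action -/

/-- `Y f = (k / 2) f` for `f` of weight `k`. -/
def opY : Module.End ℂ FormAlgebra :=
  liftForm fun k ↦ ((k : ℂ) / 2) • form k

/-- The Ramanujan connection, from forms of weight `k` to forms of weight `k + 2`. -/
def ramanujanForm (k : ℤ) : formsOfWeight k →ₗ[ℂ] formsOfWeight (k + 2) where
  toFun f := ⟨ramanujan k f, f.2.ramanujan⟩
  map_add' f g := Subtype.ext (by
    simp only [ramanujan_eq]
    exact Derivative.serreDerivative_add _ _ _ f.2.mdiff g.2.mdiff)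
  map_smul' c f := Subtype.ext (by
    simp only [ramanujan_eq]
    exact Derivative.serreDerivative_smul _ _ _ f.2.mdiff)

/-- The operator `X` on `ℳ`. -/
def opX : Module.End ℂ FormAlgebra :=
  liftForm fun k ↦ form (k + 2) ∘ₗ ramanujanForm k

/-- `μ_γ` as an element of `ℳ_2 ⊆ ℳ`. -/
def muForm (γ : GL(2, ℚ)⁺) : FormAlgebra := form 2 ⟨mu γ, isModular_mu γ⟩

theorem opY_form (k : ℤ) (f : formsOfWeight k) : opY (form k f) = ((k : ℂ) / 2) • form k f :=
  liftForm_form _ k f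

theorem opX_form (k : ℤ) (f : formsOfWeight k) :
    opX (form k f) = form (k + 2) (ramanujanForm k f) :=
  liftForm_form _ k f

theorem opY_mul (x y : FormAlgebra) : opY (x * y) = opY x * y + x * opY y := by
  induction x using form_induction with
  | h0 => simp
  | ha a b h1 h2 => simp only [add_mul, map_add, h1, h2]; abel
  | hf k f =>
    induction y using form_induction with
    | h0 => simp
    | ha a b h1 h2 => simp only [mul_add, map_add, h1, h2]; abel
    | hf l g =>
      rw [form_mul_form, opY_form, opY_form, opY_form, smul_mul_assoc, mul_smul_comm,
        form_mul_form, ← add_smul]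
      push_cast
      ring_nf

theorem opX_mul (x y : FormAlgebra) : opX (x * y) = opX x * y + x * opX y := by
  induction x using form_induction with
  | h0 => simp
  | ha a b h1 h2 => simp only [add_mul, map_add, h1, h2]; abel
  | hf k f =>
    induction y using form_induction with
    | h0 => simp
    | ha a b h1 h2 => simp only [mul_add, map_add, h1, h2]; abel
    | hf l g =>
      rw [form_mul_form, opX_form, opX_form, opX_form, form_mul_form, form_mul_form]
      have e1 : k + 2 + l = k + l + 2 := by ring
      have e2 : k + (l + 2) = k + l + 2 := by ring
      have m1 : IsModular (k + l + 2) (ramanujan k f * g) := e1 ▸ f.2.ramanujan.mul g.2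
      have m2 : IsModular (k + l + 2) (f * ramanujan l g) := e2 ▸ f.2.mul g.2.ramanujan
      rw [form_congr e1 (g := ⟨_, m1⟩) rfl, form_congr e2 (g := ⟨_, m2⟩) rfl, ← map_add]
      refine form_congr rfl ?_
      change ramanujan (k + l) (f * g) = ramanujan k f * g + f * ramanujan l g
      rw [ramanujan_eq, ramanujan_eq, ramanujan_eq, Int.cast_add]
      exact Derivative.serreDerivative_mul _ _ _ _ f.2.mdiff g.2.mdiff

theorem opY_opX (x : FormAlgebra) : opY (opX x) = opX (opY x) + opX x := by
  induction x using form_induction with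
  | h0 => simp
  | ha a b h1 h2 => simp only [map_add, h1, h2]; abel
  | hf k f =>
    rw [opX_form, opY_form, opY_form, map_smul, opX_form]
    push_cast
    module

/-- The forms `X^n (μ_γ)`, of weight `2 (n + 1)`. -/
def muIter (γ : GL(2, ℚ)⁺) (n : ℕ) : FormAlgebra := (opX ^ n) (muForm γ)

theorem opX_muIter (γ : GL(2, ℚ)⁺) (n : ℕ) : opX (muIter γ n) = muIter γ (n + 1) := by
  rw [muIter, muIter, pow_succ']; rfl

theorem opY_muIter (γ : GL(2, ℚ)⁺) (n : ℕ) :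
    opY (muIter γ n) = ((n : ℂ) + 1) • muIter γ n := by
  induction n with
  | zero =>
    change opY (muForm γ) = ((0 : ℕ) + 1 : ℂ) • muForm γ
    rw [muForm, opY_form]
    norm_num
  | succ n ih =>
    rw [← opX_muIter, opY_opX, ih, map_smul]
    push_cast
    module

/-- The coefficients of an element of `𝒜`. -/
def coeffEquiv : CrossedProduct ≃ₗ[ℂ] (GL(2, ℚ)⁺ →₀ FormAlgebra) :=
  SkewMonoidAlgebra.coeffLinearEquiv (S := ℂ)

/-- The linear map on `𝒜` with given values on the monomials `f U_γ`. -/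
def liftCross {M : Type*} [AddCommGroup M] [Module ℂ M] (φ : GL(2, ℚ)⁺ → FormAlgebra →ₗ[ℂ] M) :
    CrossedProduct →ₗ[ℂ] M :=
  Finsupp.lsum ℂ φ ∘ₗ coeffEquiv.toLinearMap

theorem liftCross_mono {M : Type*} [AddCommGroup M] [Module ℂ M]
    (φ : GL(2, ℚ)⁺ → FormAlgebra →ₗ[ℂ] M) (f : FormAlgebra) (γ : GL(2, ℚ)⁺) :
    liftCross φ (mono f γ) = φ γ f := by
  refine (Finsupp.lsum_single ℂ φ γ f)

/-- `f ↦ f U_γ` as a linear map. -/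
def monoLin (γ : GL(2, ℚ)⁺) : FormAlgebra →ₗ[ℂ] CrossedProduct :=
  coeffEquiv.symm.toLinearMap ∘ₗ Finsupp.lsingle γ

theorem monoLin_apply (γ : GL(2, ℚ)⁺) (f : FormAlgebra) : monoLin γ f = mono f γ := rfl

theorem cross_ext {M : Type*} [AddCommGroup M] [Module ℂ M] {φ ψ : CrossedProduct →ₗ[ℂ] M}
    (h : ∀ f γ, φ (mono f γ) = ψ (mono f γ)) : φ = ψ := by
  refine LinearMap.toAddMonoidHom_injective (SkewMonoidAlgebra.addHom_ext fun γ f ↦ h f γ)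

/-- An operator acting on each component of `𝒜`: `f U_γ ↦ T_γ (f) U_γ`. -/
def componentwise : (GL(2, ℚ)⁺ → Module.End ℂ FormAlgebra) →ₐ[ℂ] Module.End ℂ CrossedProduct where
  toFun T := liftCross fun γ ↦ monoLin γ ∘ₗ T γ
  map_one' := cross_ext fun f γ ↦ by rw [liftCross_mono]; rfl
  map_mul' S T := cross_ext fun f γ ↦ by
    rw [Module.End.mul_apply, liftCross_mono, liftCross_mono, LinearMap.comp_apply,
      LinearMap.comp_apply, monoLin_apply, monoLin_apply, liftCross_mono]
    rfl
  map_zero' := cross_ext fun f γ ↦ by rw [liftCross_mono]; exact map_zero (monoLin γ)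
  map_add' S T := cross_ext fun f γ ↦ by
    rw [LinearMap.add_apply, liftCross_mono, liftCross_mono, liftCross_mono]
    exact map_add (monoLin γ) _ _
  commutes' c := cross_ext fun f γ ↦ by
    rw [liftCross_mono]; exact map_smul (monoLin γ) c f

theorem componentwise_mono (T : GL(2, ℚ)⁺ → Module.End ℂ FormAlgebra) (f : FormAlgebra)
    (γ : GL(2, ℚ)⁺) : componentwise T (mono f γ) = mono (T γ f) γ :=
  liftCross_mono _ f γ

/-! ### The Hopf algebra `ℋ₁` -/

/-- The Lie algebra with basis `X`, `Y`, `δ_n` (`n ≥ 1`): the triple `(x, y, d)` stands for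
`x X + y Y + ∑ n, d n • δ_{n+1}`. -/
@[ext]
structure LieH1 : Type where
  /-- the coefficient of `X` -/
  x : ℂ
  /-- the coefficient of `Y` -/
  y : ℂ
  /-- the coefficients of the `δ_{n+1}` -/
  d : ℕ →₀ ℂ

namespace LieH1

/-- Coordinates. -/
def equiv : LieH1 ≃ ℂ × ℂ × (ℕ →₀ ℂ) where
  toFun a := (a.x, a.y, a.d)
  invFun a := ⟨a.1, a.2.1, a.2.2⟩

instance : AddCommGroup LieH1 := equiv.addCommGroup

instance : Module ℂ LieH1 := equiv.module ℂ

theorem mk_add (x y x' y' : ℂ) (d d' : ℕ →₀ ℂ) :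
    (⟨x, y, d⟩ + ⟨x', y', d'⟩ : LieH1) = ⟨x + x', y + y', d + d'⟩ := rfl

theorem mk_zero : (0 : LieH1) = ⟨0, 0, 0⟩ := rfl

theorem mk_smul (c x y : ℂ) (d : ℕ →₀ ℂ) :
    (c • ⟨x, y, d⟩ : LieH1) = ⟨c * x, c * y, c • d⟩ := rfl

/-- The shift `δ_n ↦ δ_{n+1}`. -/
def shift : (ℕ →₀ ℂ) →ₗ[ℂ] (ℕ →₀ ℂ) :=
  Finsupp.lsum ℂ fun n ↦ Finsupp.lsingle (n + 1)

/-- The grading `δ_n ↦ n δ_n`. -/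
def grade : (ℕ →₀ ℂ) →ₗ[ℂ] (ℕ →₀ ℂ) :=
  Finsupp.lsum ℂ fun n ↦ ((n : ℂ) + 1) • Finsupp.lsingle n

theorem grade_shift (d : ℕ →₀ ℂ) : grade (shift d) = shift (grade d) + shift d := by
  have : grade ∘ₗ shift = shift ∘ₗ grade + shift := by
    refine Finsupp.lhom_ext fun n c ↦ ?_
    simp only [LinearMap.comp_apply, LinearMap.add_apply, shift, grade, Finsupp.lsum_single,
      Finsupp.lsingle_apply, LinearMap.smul_apply, map_smul]
    push_cast
    module
  exact LinearMap.congr_fun this d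

/-- `[Y, X] = X`, `[Y, δ_n] = n δ_n`, `[X, δ_n] = δ_{n+1}`, `[δ_k, δ_l] = 0`. -/
instance : Bracket LieH1 LieH1 where
  bracket a b := ⟨a.y * b.x - b.y * a.x, 0,
    (a.y • grade b.d - b.y • grade a.d) + (a.x • shift b.d - b.x • shift a.d)⟩

theorem mk_bracket (x y x' y' : ℂ) (d d' : ℕ →₀ ℂ) :
    ⁅(⟨x, y, d⟩ : LieH1), (⟨x', y', d'⟩ : LieH1)⁆ = ⟨y * x' - y' * x, 0,
      (y • grade d' - y' • grade d) + (x • shift d' - x' • shift d)⟩ := rfl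

instance : LieRing LieH1 where
  add_lie := by
    rintro ⟨x, y, d⟩ ⟨x', y', d'⟩ ⟨x'', y'', d''⟩
    simp only [mk_bracket, mk_add, map_add]
    congr 1
    · ring
    · ring
    · module
  lie_add := by
    rintro ⟨x, y, d⟩ ⟨x', y', d'⟩ ⟨x'', y'', d''⟩
    simp only [mk_bracket, mk_add, map_add]
    congr 1
    · ring
    · ring
    · module
  lie_self := by
    rintro ⟨x, y, d⟩
    simp only [mk_bracket, sub_self, add_zero, mk_zero]
  leibniz_lie := by
    rintro ⟨x, y, d⟩ ⟨x', y', d'⟩ ⟨x'', y'', d''⟩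
    simp only [mk_bracket, mk_add, map_add, map_sub, map_smul, grade_shift]
    congr 1
    · ring
    · ring
    · module

instance : LieAlgebra ℂ LieH1 where
  lie_smul := by
    rintro c ⟨x, y, d⟩ ⟨x', y', d'⟩
    simp only [mk_bracket, mk_smul, map_smul]
    congr 1
    · ring
    · ring
    · module

end LieH1

/-- The Hopf algebra `ℋ₁`: as an algebra, the universal enveloping algebra of `LieH1`. -/
abbrev H1 : Type := UniversalEnvelopingAlgebra ℂ LieH1

namespace H1

attribute [local instance 100] LieRing.ofAssociativeRing LieAlgebra.ofAssociativeAlgebra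

/-- The generator `X`. -/
def X : H1 := UniversalEnvelopingAlgebra.ι ℂ (⟨1, 0, 0⟩ : LieH1)

/-- The generator `Y`. -/
def Y : H1 := UniversalEnvelopingAlgebra.ι ℂ (⟨0, 1, 0⟩ : LieH1)

/-- The generators: `delta n` is `δ_{n+1}`. -/
def delta (n : ℕ) : H1 :=
  UniversalEnvelopingAlgebra.ι ℂ (⟨0, 0, Finsupp.single n 1⟩ : LieH1)

theorem ι_bracket (a b : LieH1) : UniversalEnvelopingAlgebra.ι ℂ a * UniversalEnvelopingAlgebra.ι ℂ b -
    UniversalEnvelopingAlgebra.ι ℂ b * UniversalEnvelopingAlgebra.ι ℂ a =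
      UniversalEnvelopingAlgebra.ι ℂ ⁅a, b⁆ := by
  rw [LieHom.map_lie, LieRing.of_associative_ring_bracket]

theorem Y_X : Y * X - X * Y = X := by
  rw [X, Y, ι_bracket, LieH1.mk_bracket]
  simp

theorem X_delta (n : ℕ) : X * delta n - delta n * X = delta (n + 1) := by
  rw [X, delta, ι_bracket, LieH1.mk_bracket, delta]
  simp [LieH1.shift]

theorem Y_delta (n : ℕ) : Y * delta n - delta n * Y = ((n : ℂ) + 1) • delta n := by
  rw [Y, delta, ι_bracket, LieH1.mk_bracket]
  refine Eq.trans ?_ ((UniversalEnvelopingAlgebra.ι ℂ : LieH1 →ₗ⁅ℂ⁆ H1).map_smul'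
    ((n : ℂ) + 1) ⟨0, 0, Finsupp.single n 1⟩)
  rw [LieH1.mk_smul]
  simp [LieH1.grade]

theorem delta_comm (m n : ℕ) : delta m * delta n = delta n * delta m := by
  rw [← sub_eq_zero, delta, delta, ι_bracket, LieH1.mk_bracket]
  simp only [mul_zero, sub_self, zero_smul, add_zero, ← LieH1.mk_zero, map_zero]

section lift

variable {A : Type*} [Ring A] [Algebra ℂ A]

/-- The iterated commutators `[x, [x, … [x, d]]]`. -/
def iter (x d : A) : ℕ → A
  | 0 => d
  | n + 1 => x * iter x d n - iter x d n * x

theorem iter_grade {x y d : A} (hyx : y * x - x * y = x) (hyd : y * d - d * y = d) (n : ℕ) :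
    y * iter x d n - iter x d n * y = ((n : ℂ) + 1) • iter x d n := by
  induction n with
  | zero => simpa [iter] using hyd
  | succ n ih =>
    set e := iter x d n
    have h1 : y * x = x * y + x := by rw [← sub_eq_iff_eq_add']; exact hyx
    have h2 : y * e = e * y + ((n : ℂ) + 1) • e := by
      rw [← sub_eq_iff_eq_add']; exact ih
    change y * (x * e - e * x) - (x * e - e * x) * y = _ • (x * e - e * x)
    have h3 : y * (x * e) = x * e * y + ((n : ℂ) + 1) • (x * e) + x * e := by
      rw [← mul_assoc, h1, add_mul, mul_assoc, h2, mul_add, mul_smul_comm, mul_assoc]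
    have h4 : y * (e * x) = e * x * y + e * x + ((n : ℂ) + 1) • (e * x) := by
      rw [← mul_assoc, h2, add_mul, mul_assoc, h1, mul_add, smul_mul_assoc, mul_assoc]
    rw [mul_sub, h3, h4, sub_mul]
    push_cast
    module

/-- The homomorphism of Lie algebras with given values on `X`, `Y` and `δ_1`. -/
def liftLie (x y d : A) (hyx : y * x - x * y = x) (hyd : y * d - d * y = d)
    (hdd : ∀ m n, iter x d m * iter x d n = iter x d n * iter x d m) : LieH1 →ₗ⁅ℂ⁆ A where
  toFun a := a.x • x + a.y • y + Finsupp.linearCombination ℂ (iter x d) a.d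
  map_add' := by
    rintro ⟨a, b, c⟩ ⟨a', b', c'⟩
    simp only [LieH1.mk_add, map_add]
    module
  map_smul' := by
    rintro r ⟨a, b, c⟩
    change (r * a) • x + (r * b) • y + Finsupp.linearCombination ℂ (iter x d) (r • c) = r • _
    rw [map_smul]
    module
  map_lie' := by
    have hs (c : ℕ →₀ ℂ) : Finsupp.linearCombination ℂ (iter x d) (LieH1.shift c) =
        x * Finsupp.linearCombination ℂ (iter x d) c -
          Finsupp.linearCombination ℂ (iter x d) c * x := by
      induction c using Finsupp.induction_linear with
      | zero => simp
      | add f g hf hg => rw [map_add, map_add, map_add, hf, hg, mul_add, add_mul]; abel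
      | single n r =>
        simp [LieH1.shift, Finsupp.linearCombination_single, iter, smul_sub]
    have hg (c : ℕ →₀ ℂ) : Finsupp.linearCombination ℂ (iter x d) (LieH1.grade c) =
        y * Finsupp.linearCombination ℂ (iter x d) c -
          Finsupp.linearCombination ℂ (iter x d) c * y := by
      induction c using Finsupp.induction_linear with
      | zero => simp
      | add f g hf hg => rw [map_add, map_add, map_add, hf, hg, mul_add, add_mul]; abel
      | single n r =>
        simp only [LieH1.grade, Finsupp.lsum_single, LinearMap.smul_apply, Finsupp.lsingle_apply,
          map_smul, Finsupp.linearCombination_single, mul_smul_comm, smul_mul_assoc, ← smul_sub,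
          iter_grade hyx hyd]
        exact smul_comm _ _ _
    have hc (c c' : ℕ →₀ ℂ) : Finsupp.linearCombination ℂ (iter x d) c *
        Finsupp.linearCombination ℂ (iter x d) c' = Finsupp.linearCombination ℂ (iter x d) c' *
        Finsupp.linearCombination ℂ (iter x d) c := by
      induction c using Finsupp.induction_linear with
      | zero => simp
      | add f g hf hg => rw [map_add, add_mul, mul_add, hf, hg]
      | single n r =>
        induction c' using Finsupp.induction_linear with
        | zero => simp
        | add f g hf hg => rw [map_add, add_mul, mul_add, hf, hg]
        | single m s =>
          simp only [Finsupp.linearCombination_single, smul_mul_smul_comm, hdd n m, mul_comm r s]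
    rintro ⟨a, b, c⟩ ⟨a', b', c'⟩
    rw [LieRing.of_associative_ring_bracket]
    change (b * a' - b' * a) • x + (0 : ℂ) • y + Finsupp.linearCombination ℂ (iter x d)
      ((b • LieH1.grade c' - b' • LieH1.grade c) + (a • LieH1.shift c' - a' • LieH1.shift c)) =
      (a • x + b • y + _) * (a' • x + b' • y + _) - (a' • x + b' • y + _) * (a • x + b • y + _)
    simp only [map_add, map_sub, map_smul, hs, hg]
    have := hc c c'
    generalize Finsupp.linearCombination ℂ (iter x d) c = C at *
    generalize Finsupp.linearCombination ℂ (iter x d) c' = C' at *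
    simp only [add_mul, mul_add, smul_mul_assoc, mul_smul_comm, this]
    have h1 : y * x = x * y + x := by rw [← sub_eq_iff_eq_add']; exact hyx
    rw [h1]
    module

/-- The homomorphism of algebras on `ℋ₁` with given values on `X`, `Y` and `δ_1`. -/
def lift (x y d : A) (hyx : y * x - x * y = x) (hyd : y * d - d * y = d)
    (hdd : ∀ m n, iter x d m * iter x d n = iter x d n * iter x d m) : H1 →ₐ[ℂ] A :=
  UniversalEnvelopingAlgebra.lift ℂ (liftLie x y d hyx hyd hdd)

variable {x y d : A} {hyx : y * x - x * y = x} {hyd : y * d - d * y = d}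
    {hdd : ∀ m n, iter x d m * iter x d n = iter x d n * iter x d m}

theorem lift_X : lift x y d hyx hyd hdd X = x := by
  rw [lift, X, UniversalEnvelopingAlgebra.lift_ι_apply]
  change (1 : ℂ) • x + (0 : ℂ) • y + Finsupp.linearCombination ℂ (iter x d) 0 = x
  simp

theorem lift_Y : lift x y d hyx hyd hdd Y = y := by
  rw [lift, Y, UniversalEnvelopingAlgebra.lift_ι_apply]
  change (0 : ℂ) • x + (1 : ℂ) • y + Finsupp.linearCombination ℂ (iter x d) 0 = y
  simp

theorem lift_delta (n : ℕ) : lift x y d hyx hyd hdd (delta n) = iter x d n := by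
  rw [lift, delta, UniversalEnvelopingAlgebra.lift_ι_apply]
  change (0 : ℂ) • x + (0 : ℂ) • y + Finsupp.linearCombination ℂ (iter x d) _ = _
  simp

theorem hom_ext {φ ψ : H1 →ₐ[ℂ] A} (hX : φ X = ψ X) (hY : φ Y = ψ Y)
    (hd : φ (delta 0) = ψ (delta 0)) : φ = ψ := by
  have hdn (n : ℕ) : φ (delta n) = ψ (delta n) := by
    induction n with
    | zero => exact hd
    | succ n ih => rw [← X_delta]; simp only [map_sub, map_mul, hX, ih]
  let i : LieH1 →ₗ[ℂ] H1 := (UniversalEnvelopingAlgebra.ι ℂ : LieH1 →ₗ⁅ℂ⁆ H1)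
  let e : (ℕ →₀ ℂ) →ₗ[ℂ] LieH1 :=
    { toFun := fun c ↦ ⟨0, 0, c⟩
      map_add' := fun c c' ↦ by simp [LieH1.mk_add]
      map_smul' := fun r c ↦ by simp [LieH1.mk_smul] }
  have hl : φ.toLinearMap ∘ₗ i ∘ₗ e = ψ.toLinearMap ∘ₗ i ∘ₗ e := by
    refine Finsupp.lhom_ext' fun n ↦ LinearMap.ext_ring ?_
    exact hdn n
  refine UniversalEnvelopingAlgebra.hom_ext ℂ (LieHom.ext fun a ↦ ?_)
  obtain ⟨a, b, c⟩ := a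
  change φ (i ⟨a, b, c⟩) = ψ (i ⟨a, b, c⟩)
  have : (⟨a, b, c⟩ : LieH1) = a • ⟨1, 0, 0⟩ + b • ⟨0, 1, 0⟩ + e c := by
    change _ = a • (⟨1, 0, 0⟩ : LieH1) + b • ⟨0, 1, 0⟩ + ⟨0, 0, c⟩
    simp [LieH1.mk_smul, LieH1.mk_add]
  rw [this]
  simp only [map_add, map_smul]
  have h3 : φ (i (e c)) = ψ (i (e c)) := LinearMap.congr_fun hl c
  have h1 : φ (i ⟨1, 0, 0⟩) = ψ (i ⟨1, 0, 0⟩) := hX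
  have h2 : φ (i ⟨0, 1, 0⟩) = ψ (i ⟨0, 1, 0⟩) := hY
  rw [h1, h2, h3]

theorem iter_comm {x d : A} (S : Set A) (hS : ∀ a ∈ S, ∀ b ∈ S, a * b = b * a)
    (hd : d ∈ Algebra.adjoin ℂ S) (hx : ∀ s ∈ S, x * s - s * x ∈ Algebra.adjoin ℂ S) (m n : ℕ) :
    iter x d m * iter x d n = iter x d n * iter x d m := by
  have hx' : ∀ c ∈ Algebra.adjoin ℂ S, x * c - c * x ∈ Algebra.adjoin ℂ S := by
    intro c hc
    induction hc using Algebra.adjoin_induction with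
    | mem s hs => exact hx s hs
    | algebraMap r => rw [Algebra.commutes, sub_self]; exact zero_mem _
    | add a b _ _ ha hb =>
      rw [show x * (a + b) - (a + b) * x = (x * a - a * x) + (x * b - b * x) by noncomm_ring]
      exact add_mem ha hb
    | mul a b ha' hb' ha hb =>
      rw [show x * (a * b) - a * b * x = (x * a - a * x) * b + a * (x * b - b * x) by
        noncomm_ring]
      exact add_mem (mul_mem ha hb') (mul_mem ha' hb)
  have hmem (n : ℕ) : iter x d n ∈ Algebra.adjoin ℂ S := by
    induction n with
    | zero => exact hd
    | succ n ih => exact hx' _ ih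
  have := Algebra.isMulCommutative_adjoin ℂ hS
  exact congrArg Subtype.val (mul_comm' (⟨_, hmem m⟩ : Algebra.adjoin ℂ S) ⟨_, hmem n⟩)

end lift

/-- The modular character `δ`: `δ(X) = 0`, `δ(Y) = 1`, `δ(δ_n) = 0`. -/
def modularCharacter : H1 →ₐ[ℂ] ℂ :=
  lift 0 1 0 (by simp) (by simp) fun _ _ ↦ mul_comm _ _

/-- The counit: `ε(X) = ε(Y) = ε(δ_n) = 0`. -/
def counitHom : H1 →ₐ[ℂ] ℂ :=
  lift 0 0 0 (by simp) (by simp) fun _ _ ↦ mul_comm _ _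

theorem YX' : Y * X = X * Y + X := by rw [← sub_eq_iff_eq_add']; exact Y_X

theorem YD' (n : ℕ) : Y * delta n = delta n * Y + ((n : ℂ) + 1) • delta n := by
  rw [← sub_eq_iff_eq_add']; exact Y_delta n

theorem YD0 : Y * delta 0 = delta 0 * Y + delta 0 := by
  rw [YD']; simp

theorem XD' (n : ℕ) : X * delta n = delta n * X + delta (n + 1) := by
  rw [← sub_eq_iff_eq_add']; exact X_delta n

/-- The coproduct: `Δ X = X ⊗ 1 + 1 ⊗ X + δ_1 ⊗ Y`, `Δ Y = Y ⊗ 1 + 1 ⊗ Y`,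
`Δ δ_1 = δ_1 ⊗ 1 + 1 ⊗ δ_1`. -/
def comulHom : H1 →ₐ[ℂ] H1 ⊗[ℂ] H1 :=
  lift (X ⊗ₜ 1 + 1 ⊗ₜ X + delta 0 ⊗ₜ Y) (Y ⊗ₜ 1 + 1 ⊗ₜ Y) (delta 0 ⊗ₜ 1 + 1 ⊗ₜ delta 0)
    (by
      simp only [add_mul, mul_add, Algebra.TensorProduct.tmul_mul_tmul, one_mul, mul_one, YX',
        YD0, TensorProduct.add_tmul, TensorProduct.tmul_add]
      abel)
    (by
      simp only [add_mul, mul_add, Algebra.TensorProduct.tmul_mul_tmul, one_mul, mul_one,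
        YD0, TensorProduct.add_tmul, TensorProduct.tmul_add]
      abel)
    (iter_comm (Set.range (fun n ↦ delta n ⊗ₜ 1) ∪ Set.range (fun n ↦ 1 ⊗ₜ delta n))
      (by
        rintro _ (⟨m, rfl⟩ | ⟨m, rfl⟩) _ (⟨n, rfl⟩ | ⟨n, rfl⟩) <;>
          simp [Algebra.TensorProduct.tmul_mul_tmul, delta_comm m n])
      (add_mem (Algebra.subset_adjoin (Or.inl ⟨0, rfl⟩))
        (Algebra.subset_adjoin (Or.inr ⟨0, rfl⟩)))
      (by
        rintro _ (⟨n, rfl⟩ | ⟨n, rfl⟩)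
        · have : (X ⊗ₜ 1 + 1 ⊗ₜ X + delta 0 ⊗ₜ Y) * (delta n ⊗ₜ[ℂ] (1 : H1)) -
              (delta n ⊗ₜ[ℂ] (1 : H1)) * (X ⊗ₜ 1 + 1 ⊗ₜ X + delta 0 ⊗ₜ Y) =
              delta (n + 1) ⊗ₜ 1 := by
            simp only [add_mul, mul_add, Algebra.TensorProduct.tmul_mul_tmul, one_mul, mul_one,
              XD', TensorProduct.add_tmul, delta_comm n 0]
            abel
          simp only [this]
          exact Algebra.subset_adjoin (Or.inl ⟨n + 1, rfl⟩)
        · have : (X ⊗ₜ 1 + 1 ⊗ₜ X + delta 0 ⊗ₜ Y) * ((1 : H1) ⊗ₜ[ℂ] delta n) -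
              ((1 : H1) ⊗ₜ[ℂ] delta n) * (X ⊗ₜ 1 + 1 ⊗ₜ X + delta 0 ⊗ₜ Y) =
              1 ⊗ₜ delta (n + 1) + ((n : ℂ) + 1) • ((delta 0 ⊗ₜ 1) * (1 ⊗ₜ delta n)) := by
            simp only [add_mul, mul_add, Algebra.TensorProduct.tmul_mul_tmul, one_mul, mul_one,
              XD', YD', TensorProduct.tmul_add, TensorProduct.tmul_smul]
            abel
          simp only [this]
          refine add_mem (Algebra.subset_adjoin (Or.inr ⟨n + 1, rfl⟩))
            (Subalgebra.smul_mem _ ?_ _)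
          refine mul_mem ?_ ?_
          · exact Algebra.subset_adjoin (Or.inl ⟨0, rfl⟩)
          · exact Algebra.subset_adjoin (Or.inr ⟨n, rfl⟩)))

theorem comulHom_X : comulHom X = X ⊗ₜ 1 + 1 ⊗ₜ X + delta 0 ⊗ₜ Y := lift_X

theorem comulHom_Y : comulHom Y = Y ⊗ₜ 1 + 1 ⊗ₜ Y := lift_Y

theorem comulHom_delta : comulHom (delta 0) = delta 0 ⊗ₜ 1 + 1 ⊗ₜ delta 0 := lift_delta 0

theorem counitHom_X : counitHom X = 0 := lift_X

theorem counitHom_Y : counitHom Y = 0 := lift_Y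

theorem counitHom_delta : counitHom (delta 0) = 0 := lift_delta 0

instance : Bialgebra ℂ H1 :=
  Bialgebra.ofAlgHom comulHom counitHom
    (by
      apply hom_ext <;>
        simp [comulHom_X, comulHom_Y, comulHom_delta, TensorProduct.add_tmul,
          TensorProduct.tmul_add, Algebra.TensorProduct.one_def]
      all_goals abel)
    (by
      apply hom_ext <;>
        simp [comulHom_X, comulHom_Y, comulHom_delta, counitHom_X, counitHom_Y, counitHom_delta])
    (by
      apply hom_ext <;>
        simp [comulHom_X, comulHom_Y, comulHom_delta, counitHom_X, counitHom_Y, counitHom_delta])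

/-- The antipode, as a homomorphism to the opposite algebra: `S(X) = -X + δ_1 Y`,
`S(Y) = -Y`, `S(δ_1) = -δ_1`. -/
def antipodeHom : H1 →ₐ[ℂ] H1ᵐᵒᵖ :=
  lift (.op (-X + delta 0 * Y)) (.op (-Y)) (.op (-delta 0))
    (by
      rw [← MulOpposite.op_mul, ← MulOpposite.op_mul, ← MulOpposite.op_sub]
      congr 1
      have h : Y * (delta 0 * Y) = delta 0 * Y * Y + delta 0 * Y := by
        rw [← mul_assoc, YD0, add_mul]
      have : -Y * (-X + delta 0 * Y) = Y * X - Y * (delta 0 * Y) := by noncomm_ring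
      rw [this, h, YX']
      noncomm_ring)
    (by
      rw [← MulOpposite.op_mul, ← MulOpposite.op_mul, ← MulOpposite.op_sub]
      congr 1
      rw [neg_mul_neg, neg_mul_neg, YD0]
      abel)
    (iter_comm (Set.range fun n ↦ .op (delta n))
      (by
        rintro _ ⟨m, rfl⟩ _ ⟨n, rfl⟩
        simp only [← MulOpposite.op_mul, delta_comm m n])
      (by
        rw [MulOpposite.op_neg]
        exact neg_mem (Algebra.subset_adjoin ⟨0, rfl⟩))
      (by
        rintro _ ⟨n, rfl⟩
        have : delta n * (-X + delta 0 * Y) - (-X + delta 0 * Y) * delta n =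
            delta (n + 1) - ((n : ℂ) + 1) • (delta n * delta 0) := by
          have h1 : (-X + delta 0 * Y) * delta n = -(X * delta n) + delta 0 * (Y * delta n) := by
            noncomm_ring
          rw [h1, XD', YD', mul_add, mul_add, mul_smul_comm, delta_comm n 0, ← mul_assoc,
            ← mul_assoc, delta_comm n 0, mul_neg]
          abel
        simp only [← MulOpposite.op_mul, ← MulOpposite.op_sub, this]
        rw [MulOpposite.op_sub, MulOpposite.op_smul, MulOpposite.op_mul]
        refine sub_mem (Algebra.subset_adjoin ⟨n + 1, rfl⟩) (Subalgebra.smul_mem _ ?_ _)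
        refine mul_mem ?_ ?_
        · exact Algebra.subset_adjoin ⟨0, rfl⟩
        · exact Algebra.subset_adjoin ⟨n, rfl⟩))

theorem map_iter {A B : Type*} [Ring A] [Algebra ℂ A] [Ring B] [Algebra ℂ B] (φ : A →ₐ[ℂ] B)
    (x d : A) (n : ℕ) : φ (iter x d n) = iter (φ x) (φ d) n := by
  induction n with
  | zero => rfl
  | succ n ih => simp only [iter, map_sub, map_mul, ih]

theorem iter_X_delta (n : ℕ) : iter X (delta 0) n = delta n := by
  induction n with
  | zero => rfl
  | succ n ih => rw [iter, ih, X_delta]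

/-- A subalgebra that contains `X`, `Y` and `δ_1` is everything. -/
theorem mem_of_generators (B : Subalgebra ℂ H1) (hX : X ∈ B) (hY : Y ∈ B) (hd : delta 0 ∈ B)
    (h : H1) : h ∈ B := by
  let φ : H1 →ₐ[ℂ] B := lift ⟨X, hX⟩ ⟨Y, hY⟩ ⟨delta 0, hd⟩ (Subtype.ext Y_X)
    (Subtype.ext (by simpa using Y_delta 0)) fun m n ↦ Subtype.ext (by
      change B.val (iter _ _ m) * B.val (iter _ _ n) = B.val (iter _ _ n) * B.val (iter _ _ m)
      rw [map_iter, map_iter]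
      change iter X (delta 0) m * iter X (delta 0) n = iter X (delta 0) n * iter X (delta 0) m
      rw [iter_X_delta, iter_X_delta, delta_comm])
  have : B.val.comp φ = AlgHom.id ℂ H1 := by
    apply hom_ext
    · exact congrArg B.val lift_X
    · exact congrArg B.val lift_Y
    · exact congrArg B.val (lift_delta 0)
  rw [← AlgHom.id_apply (R := ℂ) h, ← this]
  exact (φ h).2

/-- The antipode of `ℋ₁`. -/
def antipodeLin : H1 →ₗ[ℂ] H1 :=
  (MulOpposite.opLinearEquiv ℂ).symm.toLinearMap ∘ₗ antipodeHom.toLinearMap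

theorem antipodeLin_mul (a b : H1) : antipodeLin (a * b) = antipodeLin b * antipodeLin a := by
  simp [antipodeLin]

theorem antipodeLin_one : antipodeLin 1 = 1 := by
  simp [antipodeLin]

theorem antipodeLin_X : antipodeLin X = -X + delta 0 * Y :=
  congrArg MulOpposite.unop lift_X

theorem antipodeLin_Y : antipodeLin Y = -Y :=
  congrArg MulOpposite.unop lift_Y

theorem antipodeLin_delta : antipodeLin (delta 0) = -delta 0 :=
  congrArg MulOpposite.unop (lift_delta 0)

/-- `a ⊗ b ↦ S(a) b`. -/
def leftConv : H1 ⊗[ℂ] H1 →ₗ[ℂ] H1 := LinearMap.mul' ℂ H1 ∘ₗ antipodeLin.rTensor H1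

/-- `a ⊗ b ↦ a S(b)`. -/
def rightConv : H1 ⊗[ℂ] H1 →ₗ[ℂ] H1 := LinearMap.mul' ℂ H1 ∘ₗ antipodeLin.lTensor H1

theorem leftConv_tmul (a b : H1) : leftConv (a ⊗ₜ b) = antipodeLin a * b := rfl

theorem rightConv_tmul (a b : H1) : rightConv (a ⊗ₜ b) = a * antipodeLin b := rfl

theorem leftConv_one : leftConv 1 = 1 := by
  rw [Algebra.TensorProduct.one_def, leftConv_tmul, antipodeLin_one, mul_one]

theorem leftConv_mul (t : H1 ⊗[ℂ] H1) (b c : H1) :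
    leftConv (t * (b ⊗ₜ c)) = antipodeLin b * leftConv t * c := by
  induction t using TensorProduct.induction_on with
  | zero => simp
  | add x y hx hy => rw [add_mul, map_add, hx, hy, map_add, mul_add, add_mul]
  | tmul x y =>
    rw [Algebra.TensorProduct.tmul_mul_tmul, leftConv_tmul, leftConv_tmul, antipodeLin_mul]
    noncomm_ring

theorem rightConv_one : rightConv 1 = 1 := by
  rw [Algebra.TensorProduct.one_def, rightConv_tmul, antipodeLin_one, mul_one]

theorem rightConv_mul (t : H1 ⊗[ℂ] H1) (b c : H1) :
    rightConv ((b ⊗ₜ c) * t) = b * rightConv t * antipodeLin c := by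
  induction t using TensorProduct.induction_on with
  | zero => simp
  | add x y hx hy => rw [mul_add, map_add, hx, hy, map_add, mul_add, add_mul]
  | tmul x y =>
    rw [Algebra.TensorProduct.tmul_mul_tmul, rightConv_tmul, rightConv_tmul, antipodeLin_mul]
    noncomm_ring

theorem leftConv_comul (h : H1) : leftConv (comulHom h) = algebraMap ℂ H1 (counitHom h) := by
  let B : Subalgebra ℂ H1 :=
    { carrier := {h | leftConv (comulHom h) = algebraMap ℂ H1 (counitHom h)}
      algebraMap_mem' := fun r ↦ by
        simp [Algebra.algebraMap_eq_smul_one, leftConv_one]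
      add_mem' := fun {a b} (ha : _ = _) (hb : _ = _) ↦ by
        simp only [Set.mem_ofPred_eq, map_add, ha, hb]
      mul_mem' := fun {a b} (ha : _ = _) (hb : _ = _) ↦ by
        have key (u : H1 ⊗[ℂ] H1) :
            leftConv (comulHom a * u) = algebraMap ℂ H1 (counitHom a) * leftConv u := by
          induction u using TensorProduct.induction_on with
          | zero => simp
          | add x y hx hy => rw [mul_add, map_add, hx, hy, map_add, mul_add]
          | tmul x y =>
            rw [leftConv_mul, ha, leftConv_tmul, ← Algebra.commutes, mul_assoc]
        simp only [Set.mem_ofPred_eq, map_mul, key, hb] }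
  refine mem_of_generators B ?_ ?_ ?_ h
  · change leftConv (comulHom X) = algebraMap ℂ H1 (counitHom X)
    rw [comulHom_X, counitHom_X, map_add, map_add, leftConv_tmul, leftConv_tmul, leftConv_tmul,
      antipodeLin_X, antipodeLin_one, antipodeLin_delta]
    simp
  · change leftConv (comulHom Y) = algebraMap ℂ H1 (counitHom Y)
    rw [comulHom_Y, counitHom_Y, map_add, leftConv_tmul, leftConv_tmul,
      antipodeLin_Y, antipodeLin_one]
    simp
  · change leftConv (comulHom (delta 0)) = algebraMap ℂ H1 (counitHom (delta 0))
    rw [comulHom_delta, counitHom_delta, map_add, leftConv_tmul, leftConv_tmul,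
      antipodeLin_delta, antipodeLin_one]
    simp

theorem rightConv_comul (h : H1) : rightConv (comulHom h) = algebraMap ℂ H1 (counitHom h) := by
  let B : Subalgebra ℂ H1 :=
    { carrier := {h | rightConv (comulHom h) = algebraMap ℂ H1 (counitHom h)}
      algebraMap_mem' := fun r ↦ by
        simp [Algebra.algebraMap_eq_smul_one, rightConv_one]
      add_mem' := fun {a b} (ha : _ = _) (hb : _ = _) ↦ by
        simp only [Set.mem_ofPred_eq, map_add, ha, hb]
      mul_mem' := fun {a b} (ha : _ = _) (hb : _ = _) ↦ by
        have key (u : H1 ⊗[ℂ] H1) :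
            rightConv (u * comulHom b) = rightConv u * algebraMap ℂ H1 (counitHom b) := by
          induction u using TensorProduct.induction_on with
          | zero => simp
          | add x y hx hy => rw [add_mul, map_add, hx, hy, map_add, add_mul]
          | tmul x y =>
            rw [rightConv_mul, hb, rightConv_tmul, mul_assoc, mul_assoc, Algebra.commutes]
        simp only [Set.mem_ofPred_eq, map_mul, key, ha] }
  refine mem_of_generators B ?_ ?_ ?_ h
  · change rightConv (comulHom X) = algebraMap ℂ H1 (counitHom X)
    rw [comulHom_X, counitHom_X, map_add, map_add, rightConv_tmul, rightConv_tmul, rightConv_tmul,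
      antipodeLin_X, antipodeLin_one, antipodeLin_Y]
    simp
  · change rightConv (comulHom Y) = algebraMap ℂ H1 (counitHom Y)
    rw [comulHom_Y, counitHom_Y, map_add, rightConv_tmul, rightConv_tmul,
      antipodeLin_Y, antipodeLin_one]
    simp
  · change rightConv (comulHom (delta 0)) = algebraMap ℂ H1 (counitHom (delta 0))
    rw [comulHom_delta, counitHom_delta, map_add, rightConv_tmul, rightConv_tmul,
      antipodeLin_delta, antipodeLin_one]
    simp

instance : HopfAlgebra ℂ H1 where
  antipode := antipodeLin
  mul_antipode_rTensor_comul := LinearMap.ext leftConv_comul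
  mul_antipode_lTensor_comul := LinearMap.ext rightConv_comul

end H1

/-! ### The standard action of `ℋ₁` on `𝒜` -/

theorem mulLeft_comm (f g : FormAlgebra) :
    LinearMap.mulLeft ℂ f * LinearMap.mulLeft ℂ g =
      LinearMap.mulLeft ℂ g * LinearMap.mulLeft ℂ f := by
  ext x
  simp only [Module.End.mul_apply, LinearMap.mulLeft_apply]
  ring

theorem iter_mulLeft (n : ℕ) :
    H1.iter (fun _ ↦ opX : GL(2, ℚ)⁺ → Module.End ℂ FormAlgebra)
      (fun γ ↦ LinearMap.mulLeft ℂ (muForm γ⁻¹)) n =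
        fun γ ↦ LinearMap.mulLeft ℂ (muIter γ⁻¹ n) := by
  induction n with
  | zero => rfl
  | succ n ih =>
    rw [H1.iter, ih]
    funext γ
    refine LinearMap.ext fun x ↦ ?_
    change opX (muIter γ⁻¹ n * x) - muIter γ⁻¹ n * opX x = muIter γ⁻¹ (n + 1) * x
    rw [opX_mul, opX_muIter]
    ring

/-- The standard action of `ℋ₁` on `𝒜`: `X` is the Ramanujan connection, `Y` is half the weight and
`δ_n (f U_γ^*) = X^{n-1} (μ_γ) f U_γ^*`, where `U_γ^* = U_{γ⁻¹}`. -/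
def standardAction : H1 →ₐ[ℂ] Module.End ℂ CrossedProduct :=
  componentwise.comp (H1.lift (fun _ ↦ opX) (fun _ ↦ opY)
    (fun γ ↦ LinearMap.mulLeft ℂ (muForm γ⁻¹))
    (by
      funext γ
      refine LinearMap.ext fun x ↦ ?_
      change opY (opX x) - opX (opY x) = opX x
      rw [opY_opX, add_sub_cancel_left])
    (by
      funext γ
      refine LinearMap.ext fun x ↦ ?_
      change opY (muForm γ⁻¹ * x) - muForm γ⁻¹ * opY x = muForm γ⁻¹ * x
      have h : opY (muForm γ⁻¹) = muForm γ⁻¹ := by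
        have := opY_muIter γ⁻¹ 0
        simpa [muIter] using this
      rw [opY_mul, h, add_sub_cancel_right])
    (by
      intro m n
      rw [iter_mulLeft, iter_mulLeft]
      funext γ
      exact mulLeft_comm _ _))

theorem standardAction_X (f : FormAlgebra) (γ : GL(2, ℚ)⁺) :
    standardAction H1.X (mono f γ) = mono (opX f) γ := by
  rw [standardAction, AlgHom.comp_apply, H1.lift_X, componentwise_mono]

theorem standardAction_Y (f : FormAlgebra) (γ : GL(2, ℚ)⁺) :
    standardAction H1.Y (mono f γ) = mono (opY f) γ := by
  rw [standardAction, AlgHom.comp_apply, H1.lift_Y, componentwise_mono]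

theorem standardAction_delta (n : ℕ) (f : FormAlgebra) (γ : GL(2, ℚ)⁺) :
    standardAction (H1.delta n) (mono f γ) = mono (muIter γ⁻¹ n * f) γ := by
  rw [standardAction, AlgHom.comp_apply, H1.lift_delta, iter_mulLeft, componentwise_mono]
  rfl

/-! ### The standard action is a Hopf action -/

theorem ramanujan_slash {k : ℤ} {g : ℍ → ℂ} (hg : MDiff g) (γ : GL(2, ℚ)⁺) :
    ramanujan k (slash k γ g) =
      slash (k + 2) γ (ramanujan k g) + mu γ * slash k γ (((k : ℂ) / 2) • g) := by
  have hm : mu γ = (6 : ℂ)⁻¹ • ((EisensteinSeries.E2 ∣[(2 : ℤ)] toGLReal γ) -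
      (fun z : ℍ ↦ ((12 : ℤ) : ℂ) * (2 * Real.pi * I)⁻¹ *
        (toGLReal γ 1 0 / denom (toGLReal γ) z)) - EisensteinSeries.E2) := by
    rw [mu_eq, logD_slash mdiff_discriminant ModularForm.discriminant_ne_zero, logD_discriminant]
  have hdet := toGLReal_val_det_pos γ
  have h' := toGLReal_det_pos γ
  have hσ (x) : UpperHalfPlane.σ (toGLReal γ) x = x := by
    simp only [UpperHalfPlane.σ, if_pos h', ContinuousAlgEquiv.refl_apply]
  have hf : slashFactor (k + 2) γ = ((toGLReal γ).val.det : ℂ)⁻¹ * slashFactor k γ := by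
    have hd : ((toGLReal γ).det.val : ℂ) ≠ 0 := ofReal_ne_zero.mpr h'.ne'
    rw [slashFactor, slashFactor, zpow_add₀ (sqrt_det_ne_zero γ),
      show 1 - (k + 2) = (1 - k) + (-1) + (-1) by ring, zpow_add₀ hd, zpow_add₀ hd, zpow_neg_one,
      ← Matrix.GeneralLinearGroup.val_det_apply]
    have : ((√((toGLReal γ).det.val) : ℝ) : ℂ) ^ (2 : ℤ) = ((toGLReal γ).det.val : ℂ) := by
      rw [zpow_ofNat, ← ofReal_pow, Real.sq_sqrt h'.le]
    rw [this]
    field_simp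
  simp only [ramanujan_eq]
  rw [slash_eq k γ g, Derivative.serreDerivative_smul _ _ _ (hg.slash k _), slash_eq, slash_eq, hf,
    ModularForm.smul_slash, hσ]
  ext z
  rw [Pi.smul_apply, Derivative.serreDerivative_apply,
    Derivative.normalizedDerivOfComplex_slash hg hdet, hm]
  have hz := denom_ne_zero (toGLReal γ) z
  have hd : ((toGLReal γ).val.det : ℂ) ≠ 0 := ofReal_ne_zero.mpr hdet.ne'
  simp only [Pi.add_apply, Pi.mul_apply, Pi.smul_apply, Pi.sub_apply, smul_eq_mul,
    ModularForm.slash_apply, hσ, Derivative.serreDerivative_apply,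
    Matrix.GeneralLinearGroup.val_det_apply, abs_of_pos hdet]
  rw [show k + 2 - 1 = (k - 1) + 2 by ring, show -(k + 2) = -k + -2 by ring,
    zpow_add₀ hd, zpow_add₀ hz, show (2 : ℤ) - 1 = 1 by norm_num, zpow_one, zpow_ofNat]
  push_cast
  field_simp
  ring

theorem opX_slashLin (γ : GL(2, ℚ)⁺) (g : FormAlgebra) :
    opX (slashLin γ g) = slashLin γ (opX g) + muForm γ * slashLin γ (opY g) := by
  induction g using form_induction with
  | h0 => simp
  | ha a b h1 h2 => simp only [map_add, h1, h2, mul_add]; abel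
  | hf k f =>
    rw [slashLin_form, opX_form, opX_form, slashLin_form, opY_form, ← map_smul, slashLin_form,
      muForm, form_mul_form]
    have e : 2 + k = k + 2 := by ring
    have m : IsModular (k + 2) (mu γ * slash k γ (((k : ℂ) / 2) • (f : ℍ → ℂ))) :=
      e ▸ (isModular_mu γ).mul ((f.2.smul _).slash γ)
    rw [form_congr e (g := ⟨_, m⟩) rfl, ← map_add]
    exact form_congr rfl (ramanujan_slash f.2.mdiff γ)

theorem opY_slashLin (γ : GL(2, ℚ)⁺) (g : FormAlgebra) :
    opY (slashLin γ g) = slashLin γ (opY g) := by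
  induction g using form_induction with
  | h0 => simp
  | ha a b h1 h2 => simp only [map_add, h1, h2]
  | hf k f => rw [slashLin_form, opY_form, opY_form, map_smul, slashLin_form]

theorem muForm_mul (α β : GL(2, ℚ)⁺) :
    muForm (α * β) = slashLin β (muForm α) + muForm β := by
  rw [muForm, muForm, muForm, slashLin_form, ← map_add]
  refine form_congr rfl ((mu_mul α β).trans ?_)
  have h : slashFactor 2 β = 1 := by
    have h' := toGLReal_det_pos β
    have hd : ((toGLReal β).det.val : ℂ) ≠ 0 := ofReal_ne_zero.mpr h'.ne'
    rw [slashFactor, zpow_ofNat, ← ofReal_pow, Real.sq_sqrt h'.le,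
      show (1 : ℤ) - 2 = -1 by norm_num, zpow_neg_one, mul_inv_cancel₀ hd]
  change _ = slash 2 β (mu α) + mu β
  rw [slash_eq, h, one_smul]

theorem mono_add (f g : FormAlgebra) (γ : GL(2, ℚ)⁺) : mono (f + g) γ = mono f γ + mono g γ :=
  map_add (monoLin γ) f g

theorem standardAction_X_mul_mono (f g : FormAlgebra) (α β : GL(2, ℚ)⁺) :
    standardAction H1.X (mono f α * mono g β) =
      standardAction H1.X (mono f α) * mono g β + mono f α * standardAction H1.X (mono g β) +
        standardAction (H1.delta 0) (mono f α) * standardAction H1.Y (mono g β) := by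
  simp only [mono_mul_mono, standardAction_X, standardAction_Y, standardAction_delta, ← mono_add]
  rw [opX_mul, opX_slashLin]
  congr 1
  change _ = _ + _ + muForm α⁻¹ * f * _
  ring

theorem standardAction_Y_mul_mono (f g : FormAlgebra) (α β : GL(2, ℚ)⁺) :
    standardAction H1.Y (mono f α * mono g β) =
      standardAction H1.Y (mono f α) * mono g β + mono f α * standardAction H1.Y (mono g β) := by
  simp only [mono_mul_mono, standardAction_Y, ← mono_add]
  rw [opY_mul, opY_slashLin]

theorem standardAction_delta_mul_mono (f g : FormAlgebra) (α β : GL(2, ℚ)⁺) :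
    standardAction (H1.delta 0) (mono f α * mono g β) =
      standardAction (H1.delta 0) (mono f α) * mono g β +
        mono f α * standardAction (H1.delta 0) (mono g β) := by
  simp only [mono_mul_mono, standardAction_delta, ← mono_add]
  congr 1
  change muForm (α * β)⁻¹ * _ = muForm α⁻¹ * f * _ + f * slashLin α⁻¹ (muForm β⁻¹ * g)
  rw [mul_inv_rev, muForm_mul, slashLin_map_mul]
  ring

/-! ### The cochain `τ₀` -/

/-- The integral `∫_z^w f(ζ) dζ` along the segment from `z` to `w`. -/
def lineIntegral (f : ℍ → ℂ) (z w : ℍ) : ℂ :=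
  ∫ t in (0 : ℝ)..1, f (ofComplex (z + t * (w - z))) * ((w : ℂ) - z)

theorem segment_im_pos (z w : ℍ) {t : ℝ} (ht : t ∈ Set.Icc (0 : ℝ) 1) :
    0 < ((z : ℂ) + t * (w - z)).im := by
  have hz : 0 < (z : ℂ).im := z.2
  have hw : 0 < (w : ℂ).im := w.2
  have h : ((z : ℂ) + t * (w - z)).im = (1 - t) * (z : ℂ).im + t * (w : ℂ).im := by
    simp; ring
  rw [h]
  rcases ht.1.eq_or_lt with rfl | h0
  · simpa using hz
  · have := mul_pos h0 hw
    have := mul_nonneg (sub_nonneg.mpr ht.2) hz.le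
    linarith

theorem intervalIntegrable_segment {f : ℍ → ℂ} (hf : MDiff f) (z w : ℍ) :
    IntervalIntegrable (fun t : ℝ ↦ f (ofComplex (z + t * (w - z))) * ((w : ℂ) - z))
      MeasureTheory.volume 0 1 := by
  refine ContinuousOn.intervalIntegrable ?_
  rw [Set.uIcc_of_le zero_le_one]
  refine ContinuousOn.mul ?_ continuousOn_const
  have h1 : ContinuousOn (f ∘ ofComplex) {z | 0 < z.im} :=
    (UpperHalfPlane.mdifferentiable_iff.mp hf).continuousOn
  exact h1.comp (by fun_prop) fun t ht ↦ segment_im_pos z w ht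

theorem lineIntegral_add {f g : ℍ → ℂ} (hf : MDiff f) (hg : MDiff g) (z w : ℍ) :
    lineIntegral (f + g) z w = lineIntegral f z w + lineIntegral g z w := by
  rw [lineIntegral, lineIntegral, lineIntegral, ← intervalIntegral.integral_add
    (intervalIntegrable_segment hf z w) (intervalIntegrable_segment hg z w)]
  simp only [Pi.add_apply, add_mul]

theorem lineIntegral_smul (c : ℂ) (f : ℍ → ℂ) (z w : ℍ) :
    lineIntegral (c • f) z w = c * lineIntegral f z w := by
  rw [lineIntegral, lineIntegral, ← intervalIntegral.integral_const_mul]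
  simp only [Pi.smul_apply, smul_eq_mul, mul_assoc]

/-- The bilinear form `(f⁰, f¹) ↦ ∫_{z₀}^{γ₀ z₀} f⁰ · (f¹ | γ₁) dz` on forms of weights
`k₀`, `k₁`. -/
def integralPairing (z₀ : ℍ) (k₀ k₁ : ℤ) (γ₀ γ₁ : GL(2, ℚ)⁺) :
    formsOfWeight k₀ →ₗ[ℂ] formsOfWeight k₁ →ₗ[ℂ] ℂ :=
  LinearMap.mk₂ ℂ
    (fun f₀ f₁ ↦ lineIntegral ((f₀ : ℍ → ℂ) * slash k₁ γ₁ f₁) z₀ (toGLReal γ₀ • z₀))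
    (fun f f' g ↦ by
      rw [Submodule.coe_add, add_mul]
      exact lineIntegral_add (f.2.mdiff.mul (g.2.slash γ₁).mdiff)
        (f'.2.mdiff.mul (g.2.slash γ₁).mdiff) _ _)
    (fun c f g ↦ by
      rw [Submodule.coe_smul, smul_mul_assoc, lineIntegral_smul]
      rfl)
    (fun f g g' ↦ by
      rw [Submodule.coe_add, slash_add, mul_add]
      exact lineIntegral_add (f.2.mdiff.mul (g.2.slash γ₁).mdiff)
        (f.2.mdiff.mul (g'.2.slash γ₁).mdiff) _ _)
    (fun c f g ↦ by
      rw [Submodule.coe_smul, slash_smul, mul_smul_comm, lineIntegral_smul]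
      rfl)

open Classical in
/-- The value of `τ₀` on `(f⁰ U_{γ₀}, f¹ U_{γ₁})` with `f⁰`, `f¹` homogeneous: it vanishes unless
`γ₀ γ₁ = 1` and the weights add up to `2`. -/
def tau0Homogeneous (z₀ : ℍ) (k₀ k₁ : ℤ) (γ₀ γ₁ : GL(2, ℚ)⁺) :
    formsOfWeight k₀ →ₗ[ℂ] formsOfWeight k₁ →ₗ[ℂ] ℂ :=
  if k₀ + k₁ = 2 ∧ γ₀ * γ₁ = 1 then integralPairing z₀ k₀ k₁ γ₀ γ₁ else 0

/-- The cochain `τ₀` on `𝒜`, extended bilinearly from homogeneous monomials. -/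
def tau0 (z₀ : ℍ) : CrossedProduct →ₗ[ℂ] CrossedProduct →ₗ[ℂ] ℂ :=
  liftCross fun γ₀ ↦ liftForm fun k₀ ↦
    (liftCross fun γ₁ ↦ liftForm fun k₁ ↦ (tau0Homogeneous z₀ k₀ k₁ γ₀ γ₁).flip).flip

theorem tau0_mono_eq (z₀ : ℍ) (k₀ k₁ : ℤ) (γ₀ γ₁ : GL(2, ℚ)⁺) (f₀ : formsOfWeight k₀)
    (f₁ : formsOfWeight k₁) : tau0 z₀ (mono (form k₀ f₀) γ₀) (mono (form k₁ f₁) γ₁) =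
      tau0Homogeneous z₀ k₀ k₁ γ₀ γ₁ f₀ f₁ := by
  rw [tau0, liftCross_mono, liftForm_form, LinearMap.flip_apply, liftCross_mono, liftForm_form,
    LinearMap.flip_apply]

theorem tau0_mono (z₀ : ℍ) {k₀ k₁ : ℤ} {γ₀ γ₁ : GL(2, ℚ)⁺} (hk : k₀ + k₁ = 2)
    (hγ : γ₀ * γ₁ = 1) (f₀ : formsOfWeight k₀) (f₁ : formsOfWeight k₁) :
    tau0 z₀ (mono (form k₀ f₀) γ₀) (mono (form k₁ f₁) γ₁) =
      lineIntegral ((f₀ : ℍ → ℂ) * slash k₁ γ₁ f₁) z₀ (toGLReal γ₀ • z₀) := by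
  rw [tau0_mono_eq, tau0Homogeneous, if_pos ⟨hk, hγ⟩]
  rfl

theorem tau0_mono_of_not (z₀ : ℍ) {k₀ k₁ : ℤ} {γ₀ γ₁ : GL(2, ℚ)⁺}
    (h : ¬(k₀ + k₁ = 2 ∧ γ₀ * γ₁ = 1)) (f₀ : formsOfWeight k₀) (f₁ : formsOfWeight k₁) :
    tau0 z₀ (mono (form k₀ f₀) γ₀) (mono (form k₁ f₁) γ₁) = 0 := by
  rw [tau0_mono_eq, tau0Homogeneous, if_neg h]
  rfl

/-! ### Cyclic cocycles and invariance -/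

/-- A bilinear form `τ` is a cyclic `1`-cocycle on `𝒜`: it is cyclic,
`τ(a⁰, a¹) = - τ(a¹, a⁰)`, and its Hochschild coboundary
`b τ (a⁰, a¹, a²) = τ(a⁰a¹, a²) - τ(a⁰, a¹a²) + τ(a²a⁰, a¹)` vanishes. -/
def IsCyclicOneCocycle (τ : CrossedProduct →ₗ[ℂ] CrossedProduct →ₗ[ℂ] ℂ) : Prop :=
  (∀ a₀ a₁, τ a₀ a₁ = -τ a₁ a₀) ∧
    ∀ a₀ a₁ a₂, τ (a₀ * a₁) a₂ - τ a₀ (a₁ * a₂) + τ (a₂ * a₀) a₁ = 0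

/-- For `t = ∑ x ⊗ y` in `ℋ₁ ⊗ ℋ₁`, the value `∑ τ(x a⁰, y a¹)`. -/
def evalTensor (ρ : H1 →ₐ[ℂ] Module.End ℂ CrossedProduct)
    (τ : CrossedProduct →ₗ[ℂ] CrossedProduct →ₗ[ℂ] ℂ) (a₀ a₁ : CrossedProduct) :
    H1 ⊗[ℂ] H1 →ₗ[ℂ] ℂ :=
  TensorProduct.lift (τ.compl₁₂ (ρ.toLinearMap.flip a₀) (ρ.toLinearMap.flip a₁))

theorem evalTensor_tmul (ρ : H1 →ₐ[ℂ] Module.End ℂ CrossedProduct)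
    (τ : CrossedProduct →ₗ[ℂ] CrossedProduct →ₗ[ℂ] ℂ) (a₀ a₁ : CrossedProduct) (x y : H1) :
    evalTensor ρ τ a₀ a₁ (x ⊗ₜ y) = τ (ρ x a₀) (ρ y a₁) := rfl

/-- Invariance of `τ` with respect to the modular character `δ`:
`∑ τ(h₍₁₎ a⁰, h₍₂₎ a¹) = δ(h) τ(a⁰, a¹)` for all `h` in `ℋ₁`. -/
def IsDeltaInvariant (ρ : H1 →ₐ[ℂ] Module.End ℂ CrossedProduct)
    (τ : CrossedProduct →ₗ[ℂ] CrossedProduct →ₗ[ℂ] ℂ) : Prop :=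
  ∀ (h : H1) (a₀ a₁ : CrossedProduct),
    evalTensor ρ τ a₀ a₁ (Coalgebra.comul (R := ℂ) h) = H1.modularCharacter h * τ a₀ a₁

end ModularSymbol

end

noncomputable section

namespace ModularSymbol

/-! ### Line integrals of holomorphic functions on the upper half-plane -/

/-! Everything reduces to the functionals P(z, w): x ↦ ∫_z^w x₂ dζ on ℳ, where x₂ is the component
of weight 2 (`period`). On monomials, τ₀(f U_α, g U_β) is P(z₀, αz₀)(f · g|β) when αβ = 1 and zero
otherwise (`tau0_mono_of_mul_eq_one`, `tau0_mono_of_mul_ne_one`). Four properties of P carry the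
proof. It is additive along paths, because holomorphic functions on ℍ have primitives
(`period_add_adjacent`). It satisfies P(z, w)(x|γ) = P(γz, γw)(x), because the weight 2 slash is the
pullback of the differential f dζ (`period_slashLin`). It kills the image of X: X raises the weight
by 2, so only forms of weight 0 contribute, and these are constants, which X annihilates
(`period_opX`). Finally P ∘ Y = P, since Y is the identity in weight 2 (`period_opY`).

The cocycle identities are then statements about paths. Cyclicity says that z₀ → αz₀ → z₀ is closed.
In the Hochschild coboundary the three terms become integrals of a single form over z₀ → αβz₀, z₀ →
αz₀ and αβz₀ → αz₀, which cancel.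

For invariance, the elements h that satisfy the identity for all arguments form a subalgebra of ℋ₁,
so X, Y and δ₁ suffice. Both X and Y are derivations of ℳ. Y commutes with the slash action and X
does so up to μ_β · Y. The term δ₁ ⊗ Y of the coproduct supplies exactly this defect, so the three
terms for X add up to P(X(f · g|β)) = 0. For Y the sum is P(Y(f · g|β)) = P(f · g|β), whence δ(Y) =
1. For δ₁ the integrand itself vanishes, by the cocycle relation for μ. -/

theorem exists_primitive {f : ℍ → ℂ} (hf : MDiff f) :
    ∃ F : ℂ → ℂ, ∀ z : ℍ, HasDerivAt F (f z) z := by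
  -- Convexity of the half-plane gives a holomorphic primitive on it; openness then upgrades
  -- derivatives within the set to derivatives.
  obtain ⟨F, hF⟩ := (convex_halfSpace_im_gt 0).exists_forall_hasDerivWithinAt
    (UpperHalfPlane.mdifferentiable_iff.mp hf)
  refine ⟨F, fun z ↦ ?_⟩
  have h := (hF z z.2).hasDerivAt (isOpen_upperHalfPlaneSet.mem_nhds z.2)
  simpa using h

/-- This is the fundamental theorem of calculus along the segment, which stays in ℍ. Nothing is
asked of `F` outside ℍ, so any formula that is a primitive there can be used. -/
theorem lineIntegral_eq_sub {f : ℍ → ℂ} (hf : MDiff f) {F : ℂ → ℂ}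
    (hF : ∀ z : ℍ, HasDerivAt F (f z) z) (z w : ℍ) : lineIntegral f z w = F w - F z := by
  have hd : ∀ t ∈ Set.uIcc (0 : ℝ) 1, HasDerivAt (fun t : ℝ ↦ F (z + t * (w - z)))
      (f (ofComplex (z + t * (w - z))) * ((w : ℂ) - z)) t := by
    intro t ht
    rw [Set.uIcc_of_le zero_le_one] at ht
    have hp := segment_im_pos z w ht
    have h1 : HasDerivAt F (f (ofComplex (z + t * (w - z)))) ((z : ℂ) + t * (w - z)) := by
      rw [ofComplex_apply_of_im_pos hp]
      exact hF ⟨_, hp⟩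
    have h2 : HasDerivAt (fun t : ℝ ↦ (z : ℂ) + t * (w - z)) ((w : ℂ) - z) t := by
      simpa using ((ofRealCLM.hasDerivAt (x := t)).mul_const ((w : ℂ) - z)).const_add (z : ℂ)
    exact h1.comp t h2
  rw [lineIntegral, intervalIntegral.integral_eq_sub_of_hasDerivAt hd
    (intervalIntegrable_segment hf z w)]
  simp

/-- Two sides of a triangle are traded for the third: this is path independence, read off from the
endpoint values of one primitive. -/
theorem lineIntegral_add_adjacent {f : ℍ → ℂ} (hf : MDiff f) (z w v : ℍ) :
    lineIntegral f z w + lineIntegral f w v = lineIntegral f z v := by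
  obtain ⟨F, hF⟩ := exists_primitive hf
  simp only [lineIntegral_eq_sub hf hF]
  ring

/-- The change of variables `ζ ↦ γ ζ` in a line integral. -/
theorem lineIntegral_slash {f : ℍ → ℂ} (hf : MDiff f) (γ : GL(2, ℚ)⁺) (z w : ℍ) :
    lineIntegral (slash 2 γ f) z w = lineIntegral f (toGLReal γ • z) (toGLReal γ • w) := by
  obtain ⟨F, hF⟩ := exists_primitive hf
  have hdet := toGLReal_det_pos γ
  have hs : MDiff (slash 2 γ f) := by
    rw [slash_eq]
    exact (hf.slash 2 _).const_smul _
  -- In general γ does not map segments to segments, so no substitution is made in the integral.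
  -- Instead F ∘ γ is shown to be a primitive of the slashed form: the derivative of γ is det(γ)(cζ
  -- + d)⁻², which is the automorphy factor of weight 2.
  have hG (ζ : ℍ) : HasDerivAt (fun u ↦ F (num (toGLReal γ) u / denom (toGLReal γ) u))
      (slash 2 γ f ζ) ζ := by
    have h0 := denom_ne_zero (toGLReal γ) ζ
    have hn : HasDerivAt (num (toGLReal γ)) (toGLReal γ 0 0 : ℂ) ζ := by
      exact ((hasDerivAt_id (ζ : ℂ)).const_mul (toGLReal γ 0 0 : ℂ)).add_const
        (toGLReal γ 0 1 : ℂ) |>.congr_deriv (mul_one _)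
    have hd : HasDerivAt (denom (toGLReal γ)) (toGLReal γ 1 0 : ℂ) ζ := by
      exact ((hasDerivAt_id (ζ : ℂ)).const_mul (toGLReal γ 1 0 : ℂ)).add_const
        (toGLReal γ 1 1 : ℂ) |>.congr_deriv (mul_one _)
    have h1 := hF (toGLReal γ • ζ)
    rw [coe_smul_of_det_pos hdet] at h1
    refine (h1.comp (ζ : ℂ) (hn.div hd h0)).congr_deriv ?_
    have hsq : ((√((toGLReal γ).det.val) : ℝ) : ℂ) ^ (2 : ℤ) = ((toGLReal γ).det.val : ℂ) := by
      rw [zpow_ofNat, ← ofReal_pow, Real.sq_sqrt hdet.le]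
    rw [slash, hsq, zpow_neg, zpow_ofNat, Matrix.GeneralLinearGroup.val_det_apply,
      Matrix.det_fin_two]
    field_simp
    simp only [num, denom]
    push_cast
    ring
  rw [lineIntegral_eq_sub hs hG, lineIntegral_eq_sub hf hF, coe_smul_of_det_pos hdet,
    coe_smul_of_det_pos hdet]

/-! ### Forms of weight zero -/

theorem IsModular.exists_eq_const {f : ℍ → ℂ} (hf : IsModular 0 f) :
    ∃ c : ℂ, f = fun _ ↦ c := by
  obtain ⟨N, hN, F, rfl⟩ := hf
  have : NeZero N := ⟨hN⟩
  obtain ⟨c, hc⟩ := F.eq_const_of_weight_zero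
  exact ⟨c, hc⟩

/-- A form of weight 0 and level N, being holomorphic at the cusps, is constant, so its derivative
vanishes; the η-correction carries the factor k/2 = 0. -/
theorem ramanujan_weight_zero {f : ℍ → ℂ} (hf : IsModular 0 f) : ramanujan 0 f = 0 := by
  obtain ⟨c, rfl⟩ := hf.exists_eq_const
  ext z
  have : ((fun _ ↦ c : ℍ → ℂ) ∘ ofComplex) = fun _ ↦ c := rfl
  simp [ramanujan, this]

/-! ### Period functionals on `ℳ` -/

/-- The functional `f ↦ ∫_z^w f_2(ζ) dζ` on `ℳ`, where `f_2` is the component of weight `2`. -/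
def period (z w : ℍ) : FormAlgebra →ₗ[ℂ] ℂ where
  toFun x := lineIntegral (component 2 x : ℍ → ℂ) z w
  map_add' x y := by
    rw [map_add, Submodule.coe_add]
    exact lineIntegral_add (component 2 x).2.mdiff (component 2 y).2.mdiff z w
  map_smul' c x := by
    rw [map_smul, Submodule.coe_smul, lineIntegral_smul]
    rfl

theorem period_apply (z w : ℍ) (x : FormAlgebra) :
    period z w x = lineIntegral (component 2 x : ℍ → ℂ) z w := rfl

theorem period_form {k : ℤ} (hk : k = 2) (z w : ℍ) (f : formsOfWeight k) :
    period z w (form k f) = lineIntegral (f : ℍ → ℂ) z w := by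
  subst hk
  rw [period_apply]
  congr 2

theorem period_form_of_ne {k : ℤ} (hk : k ≠ 2) (z w : ℍ) (f : formsOfWeight k) :
    period z w (form k f) = 0 := by
  have h : component 2 (form k f) = 0 :=
    DirectSum.of_eq_of_ne (β := fun k ↦ formsOfWeight k) k 2 f hk.symm
  simp [period_apply, h, lineIntegral]

theorem period_add_adjacent (z w v : ℍ) (x : FormAlgebra) :
    period z w x + period w v x = period z v x :=
  lineIntegral_add_adjacent (component 2 x).2.mdiff z w v

theorem period_self (z : ℍ) (x : FormAlgebra) : period z z x = 0 := by
  simp [period_apply, lineIntegral]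

/-- The slash action preserves weights, so only the weight 2 component matters on either side, and
there the identity is the change of variables `lineIntegral_slash`. -/
theorem period_slashLin (γ : GL(2, ℚ)⁺) (z w : ℍ) (x : FormAlgebra) :
    period z w (slashLin γ x) = period (toGLReal γ • z) (toGLReal γ • w) x := by
  induction x using form_induction with
  | h0 => simp
  | ha a b h1 h2 => simp only [map_add, h1, h2]
  | hf k f =>
    rw [slashLin_form]
    by_cases hk : k = 2
    · rw [period_form hk, period_form hk]
      subst hk
      exact lineIntegral_slash f.2.mdiff γ z w
    · rw [period_form_of_ne hk, period_form_of_ne hk]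

/-- The weight 2 component of X x comes from the weight 0 component of x alone, and X annihilates
forms of weight 0. This is where holomorphy at the cusps enters the invariance of τ₀. -/
theorem period_opX (z w : ℍ) (x : FormAlgebra) : period z w (opX x) = 0 := by
  induction x using form_induction with
  | h0 => simp
  | ha a b h1 h2 => simp only [map_add, h1, h2, add_zero]
  | hf k f =>
    rw [opX_form]
    by_cases hk : k = 0
    · subst hk
      have : ramanujanForm 0 f = 0 := Subtype.ext (ramanujan_weight_zero f.2)
      rw [this, map_zero, map_zero]
    · exact period_form_of_ne (by omega) z w _

/-- Y acts on weight 2 by 2/2 = 1, and the other weights are not seen by the functional. This is the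
source of δ(Y) = 1. -/
theorem period_opY (z w : ℍ) (x : FormAlgebra) : period z w (opY x) = period z w x := by
  induction x using form_induction with
  | h0 => simp
  | ha a b h1 h2 => simp only [map_add, h1, h2]
  | hf k f =>
    rw [opY_form, map_smul]
    by_cases hk : k = 2
    · subst hk
      simp
    · rw [period_form_of_ne hk, smul_zero]

/-! ### The values of `τ₀` on monomials -/

theorem tau0_mono_of_mul_ne_one (z₀ : ℍ) {α β : GL(2, ℚ)⁺} (h : α * β ≠ 1) (f g : FormAlgebra) :
    tau0 z₀ (mono f α) (mono g β) = 0 := by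
  induction f using form_induction with
  | h0 => rw [← monoLin_apply]; simp
  | ha a b h1 h2 => rw [mono_add, map_add, LinearMap.add_apply, h1, h2, add_zero]
  | hf k f =>
    induction g using form_induction with
    | h0 => rw [← monoLin_apply β]; simp
    | ha a b h1 h2 => rw [mono_add, map_add, h1, h2, add_zero]
    | hf l g => exact tau0_mono_of_not z₀ (fun h' ↦ h h'.2) f g

/-- The condition that the weights add up to 2 is absorbed by `period`, which reads only the weight
2 component of the product. Hence the formula holds for inhomogeneous coefficients, and later
arguments need not track weights. -/
theorem tau0_mono_of_mul_eq_one (z₀ : ℍ) {α β : GL(2, ℚ)⁺} (h : α * β = 1) (f g : FormAlgebra) :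
    tau0 z₀ (mono f α) (mono g β) = period z₀ (toGLReal α • z₀) (f * slashLin β g) := by
  induction f using form_induction with
  | h0 => rw [← monoLin_apply]; simp
  | ha a b h1 h2 => rw [mono_add, map_add, LinearMap.add_apply, h1, h2, add_mul, map_add]
  | hf k f =>
    induction g using form_induction with
    | h0 => rw [← monoLin_apply β]; simp
    | ha a b h1 h2 => rw [mono_add, map_add, h1, h2, map_add, mul_add, map_add]
    | hf l g =>
      rw [slashLin_form, form_mul_form]
      by_cases hk : k + l = 2
      · rw [tau0_mono z₀ hk h, period_form hk]
        rfl
      · rw [tau0_mono_of_not z₀ (fun h' ↦ hk h'.1), period_form_of_ne hk]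

/-- A bilinear identity on `𝒜` holds once it holds on monomials. -/
theorem cross_ext₂ {M : Type*} [AddCommGroup M] [Module ℂ M]
    {φ ψ : CrossedProduct →ₗ[ℂ] CrossedProduct →ₗ[ℂ] M}
    (h : ∀ f α g β, φ (mono f α) (mono g β) = ψ (mono f α) (mono g β)) : φ = ψ :=
  cross_ext fun f α ↦ cross_ext fun g β ↦ h f α g β

theorem cross_induction {p : CrossedProduct → Prop} (a : CrossedProduct) (h0 : p 0)
    (hm : ∀ f γ, p (mono f γ)) (ha : ∀ a b, p a → p b → p (a + b)) : p a :=
  SkewMonoidAlgebra.induction_on a h0 (fun γ f ↦ hm f γ) ha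

/-! ### `τ₀` is a cyclic cocycle -/

/-- Put x = f · g|β. Since βα = 1, the integrand of the exchanged term is x|α, so that term is the
integral of x over αz₀ → αβz₀ = z₀. Together with z₀ → αz₀ this closes up. -/
theorem tau0_mono_cyclic (z₀ : ℍ) (f g : FormAlgebra) (α β : GL(2, ℚ)⁺) :
    tau0 z₀ (mono f α) (mono g β) = -tau0 z₀ (mono g β) (mono f α) := by
  by_cases h : α * β = 1
  · have h' : β * α = 1 := mul_eq_one_comm.mp h
    have e : g * slashLin α f = slashLin α (f * slashLin β g) := by
      rw [slashLin_map_mul, ← slashLin_mul, h', slashLin_one, mul_comm]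
    rw [tau0_mono_of_mul_eq_one z₀ h, tau0_mono_of_mul_eq_one z₀ h', e, period_slashLin,
      smul_smul, ← map_mul, h, map_one, one_smul, eq_neg_iff_add_eq_zero, period_add_adjacent,
      period_self]
  · have h' : β * α ≠ 1 := fun h' ↦ h (mul_eq_one_comm.mp h')
    rw [tau0_mono_of_mul_ne_one z₀ h, tau0_mono_of_mul_ne_one z₀ h', neg_zero]

/-- Moved to the common integrand x = f · g|α⁻¹ · h|γ, the three terms run over z₀ → αβz₀, z₀ → αz₀
and αβz₀ → αz₀, so the alternating sum telescopes. -/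
theorem tau0_mono_cocycle (z₀ : ℍ) (f g h : FormAlgebra) (α β γ : GL(2, ℚ)⁺) :
    tau0 z₀ (mono f α * mono g β) (mono h γ) - tau0 z₀ (mono f α) (mono g β * mono h γ) +
      tau0 z₀ (mono h γ * mono f α) (mono g β) = 0 := by
  simp only [mono_mul_mono]
  by_cases h1 : α * β * γ = 1
  · have h2 : α * (β * γ) = 1 := by rw [← mul_assoc, h1]
    -- The condition that the product is 1 is stable under cyclic permutation, so the three terms
    -- are nonzero only simultaneously.
    have h3 : γ * α * β = 1 := by rw [mul_assoc]; exact mul_eq_one_comm.mp h1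
    have e1 : β * γ = α⁻¹ := eq_inv_of_mul_eq_one_right h2
    have e2 : γ = (α * β)⁻¹ := eq_inv_of_mul_eq_one_right h1
    set x := f * slashLin α⁻¹ g * slashLin γ h with hx
    have hx2 : f * slashLin (β * γ) (g * slashLin β⁻¹ h) = x := by
      rw [slashLin_map_mul, ← slashLin_mul, inv_mul_cancel_left, e1, hx, mul_assoc]
    -- The third integrand is x|γ⁻¹ and not x; the change of variables by γ⁻¹ moves its path to the
    -- endpoints given by `p1` and `p2`.
    have hx3 : h * slashLin γ⁻¹ f * slashLin β g = slashLin γ⁻¹ x := by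
      rw [hx, slashLin_map_mul, slashLin_map_mul, ← slashLin_mul, ← slashLin_mul, mul_inv_cancel,
        slashLin_one, show α⁻¹ * γ⁻¹ = β by rw [e2]; group]
      ring
    have p1 : toGLReal γ⁻¹ • z₀ = toGLReal (α * β) • z₀ := by rw [e2, inv_inv]
    have p2 : toGLReal γ⁻¹ • toGLReal (γ * α) • z₀ = toGLReal α • z₀ := by
      rw [smul_smul, ← map_mul, inv_mul_cancel_left]
    rw [tau0_mono_of_mul_eq_one z₀ h1, tau0_mono_of_mul_eq_one z₀ h2,
      tau0_mono_of_mul_eq_one z₀ h3, ← hx, hx2, hx3, period_slashLin, p1, p2,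
      ← period_add_adjacent z₀ (toGLReal (α * β) • z₀) (toGLReal α • z₀)]
    ring
  · have h2 : α * (β * γ) ≠ 1 := by rwa [← mul_assoc]
    have h3 : γ * α * β ≠ 1 := by
      rw [mul_assoc]; exact fun h' ↦ h1 (mul_eq_one_comm.mp h')
    rw [tau0_mono_of_mul_ne_one z₀ h1, tau0_mono_of_mul_ne_one z₀ h2,
      tau0_mono_of_mul_ne_one z₀ h3, sub_zero, add_zero]

theorem isCyclicOneCocycle_tau0 (z₀ : ℍ) : IsCyclicOneCocycle (tau0 z₀) := by
  refine ⟨fun a₀ a₁ ↦ ?_, fun a₀ a₁ a₂ ↦ ?_⟩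
  · have h : tau0 z₀ = -(tau0 z₀).flip :=
      cross_ext₂ fun f α g β ↦ tau0_mono_cyclic z₀ f g α β
    exact LinearMap.congr_fun₂ h a₀ a₁
  · induction a₀ using cross_induction with
    | h0 => simp
    | ha a b h1 h2 =>
      simp only [add_mul, mul_add, map_add, LinearMap.add_apply]
      linear_combination h1 + h2
    | hm f α =>
      induction a₁ using cross_induction with
      | h0 => simp
      | ha a b h1 h2 =>
        simp only [add_mul, mul_add, map_add, LinearMap.add_apply]
        linear_combination h1 + h2
      | hm g β =>
        induction a₂ using cross_induction with
        | h0 => simp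
        | ha a b h1 h2 =>
          simp only [add_mul, mul_add, map_add, LinearMap.add_apply]
          linear_combination h1 + h2
        | hm h γ => exact tau0_mono_cocycle z₀ f g h α β γ

/-! ### Invariance of `τ₀` -/

/-! ### Reduction to generators of ℋ₁ -/

/-- Since ρ is multiplicative, the right factor acts first and can be moved into the arguments of τ.
This makes invariance compatible with products in ℋ₁. -/
theorem evalTensor_mul_tmul (ρ : H1 →ₐ[ℂ] Module.End ℂ CrossedProduct)
    (τ : CrossedProduct →ₗ[ℂ] CrossedProduct →ₗ[ℂ] ℂ) (a₀ a₁ : CrossedProduct)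
    (t : H1 ⊗[ℂ] H1) (x y : H1) :
    evalTensor ρ τ a₀ a₁ (t * (x ⊗ₜ y)) = evalTensor ρ τ (ρ x a₀) (ρ y a₁) t := by
  induction t using TensorProduct.induction_on with
  | zero => simp
  | add s t hs ht => rw [add_mul, map_add, map_add, hs, ht]
  | tmul u v =>
    simp only [Algebra.TensorProduct.tmul_mul_tmul, evalTensor_tmul, map_mul,
      Module.End.mul_apply]

/-- Invariance under `ℋ₁` follows from invariance under the generators `X`, `Y` and `δ_1`. -/
theorem isDeltaInvariant_of_generators {ρ : H1 →ₐ[ℂ] Module.End ℂ CrossedProduct}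
    {τ : CrossedProduct →ₗ[ℂ] CrossedProduct →ₗ[ℂ] ℂ}
    (hX : ∀ a₀ a₁, τ (ρ H1.X a₀) a₁ + τ a₀ (ρ H1.X a₁) +
      τ (ρ (H1.delta 0) a₀) (ρ H1.Y a₁) = 0)
    (hY : ∀ a₀ a₁, τ (ρ H1.Y a₀) a₁ + τ a₀ (ρ H1.Y a₁) = τ a₀ a₁)
    (hd : ∀ a₀ a₁, τ (ρ (H1.delta 0) a₀) a₁ + τ a₀ (ρ (H1.delta 0) a₁) = 0) :
    IsDeltaInvariant ρ τ := by
  let B : Subalgebra ℂ H1 :=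
    { carrier := {h | ∀ a₀ a₁, evalTensor ρ τ a₀ a₁ (H1.comulHom h) =
        H1.modularCharacter h * τ a₀ a₁}
      algebraMap_mem' := fun r a₀ a₁ ↦ by
        simp [Algebra.algebraMap_eq_smul_one, Algebra.TensorProduct.one_def, evalTensor_tmul]
      add_mem' := fun {a b} ha hb a₀ a₁ ↦ by
        rw [map_add, map_add, map_add, ha, hb, add_mul]
      mul_mem' := fun {a b} ha hb a₀ a₁ ↦ by
        -- Invariance under `a` is applied at the modified arguments ρ(x) a₀ and ρ(y) a₁; hence the
        -- quantifiers over a₀ and a₁ in the carrier of `B`.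
        have key (u : H1 ⊗[ℂ] H1) : evalTensor ρ τ a₀ a₁ (H1.comulHom a * u) =
            H1.modularCharacter a * evalTensor ρ τ a₀ a₁ u := by
          induction u using TensorProduct.induction_on with
          | zero => simp
          | add x y hx hy => rw [mul_add, map_add, hx, hy, map_add, mul_add]
          | tmul x y => rw [evalTensor_mul_tmul, ha, evalTensor_tmul]
        rw [map_mul H1.comulHom, key, hb, map_mul, mul_assoc] }
  intro h
  -- The comultiplication of the `Bialgebra` instance is `H1.comulHom` by definition, so membership
  -- in `B` is the goal.
  refine H1.mem_of_generators B ?_ ?_ ?_ h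
  · intro a₀ a₁
    rw [H1.comulHom_X, H1.modularCharacter, H1.lift_X]
    simpa [evalTensor_tmul] using hX a₀ a₁
  · intro a₀ a₁
    rw [H1.comulHom_Y, H1.modularCharacter, H1.lift_Y]
    simpa [evalTensor_tmul] using hY a₀ a₁
  · intro a₀ a₁
    rw [H1.comulHom_delta, H1.modularCharacter, H1.lift_delta]
    simpa [evalTensor_tmul, H1.iter] using hd a₀ a₁

/-! ### Invariance under X, Y and δ₁ -/

/-- The cocycle relation at 1 · 1 reads μ₁ = μ₁ + μ₁. -/
theorem muForm_one : muForm 1 = 0 := by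
  have h := muForm_mul 1 1
  rwa [mul_one, slashLin_one, left_eq_add] at h

theorem tau0_X_invariant (z₀ : ℍ) (a₀ a₁ : CrossedProduct) :
    tau0 z₀ (standardAction H1.X a₀) a₁ + tau0 z₀ a₀ (standardAction H1.X a₁) +
      tau0 z₀ (standardAction (H1.delta 0) a₀) (standardAction H1.Y a₁) = 0 := by
  have h : (tau0 z₀).compl₁₂ (standardAction H1.X) LinearMap.id +
      (tau0 z₀).compl₁₂ LinearMap.id (standardAction H1.X) +
      (tau0 z₀).compl₁₂ (standardAction (H1.delta 0)) (standardAction H1.Y) = 0 := by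
    refine cross_ext₂ fun f α g β ↦ ?_
    simp only [LinearMap.add_apply, LinearMap.compl₁₂_apply, LinearMap.id_apply,
      LinearMap.zero_apply, standardAction_X, standardAction_Y, standardAction_delta]
    by_cases hαβ : α * β = 1
    · simp only [tau0_mono_of_mul_eq_one z₀ hαβ, ← map_add]
      convert period_opX z₀ (toGLReal α • z₀) (f * slashLin β g) using 2
      -- With α⁻¹ = β, δ₁ acts on f U_α as multiplication by μ_β, the very form that measures the
      -- failure of X to commute with the slash by β. The three terms are thus the Leibniz expansion
      -- of X(f · g|β).
      rw [opX_mul, opX_slashLin, ← eq_inv_of_mul_eq_one_right hαβ]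
      change _ + muForm β * f * _ = _
      ring
    · simp only [tau0_mono_of_mul_ne_one z₀ hαβ, add_zero]
  exact LinearMap.congr_fun₂ h a₀ a₁

theorem tau0_Y_invariant (z₀ : ℍ) (a₀ a₁ : CrossedProduct) :
    tau0 z₀ (standardAction H1.Y a₀) a₁ + tau0 z₀ a₀ (standardAction H1.Y a₁) =
      tau0 z₀ a₀ a₁ := by
  have h : (tau0 z₀).compl₁₂ (standardAction H1.Y) LinearMap.id +
      (tau0 z₀).compl₁₂ LinearMap.id (standardAction H1.Y) = tau0 z₀ := by
    refine cross_ext₂ fun f α g β ↦ ?_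
    simp only [LinearMap.add_apply, LinearMap.compl₁₂_apply, LinearMap.id_apply,
      standardAction_Y]
    by_cases hαβ : α * β = 1
    · simp only [tau0_mono_of_mul_eq_one z₀ hαβ, ← map_add]
      -- Y is inserted on the right-hand side, where the Leibniz rule and its commutation with the
      -- slash produce the left-hand side.
      rw [← period_opY z₀ _ (f * slashLin β g), opY_mul, opY_slashLin]
    · simp only [tau0_mono_of_mul_ne_one z₀ hαβ, add_zero]
  exact LinearMap.congr_fun₂ h a₀ a₁

theorem tau0_delta_invariant (z₀ : ℍ) (a₀ a₁ : CrossedProduct) :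
    tau0 z₀ (standardAction (H1.delta 0) a₀) a₁ +
      tau0 z₀ a₀ (standardAction (H1.delta 0) a₁) = 0 := by
  have h : (tau0 z₀).compl₁₂ (standardAction (H1.delta 0)) LinearMap.id +
      (tau0 z₀).compl₁₂ LinearMap.id (standardAction (H1.delta 0)) = 0 := by
    refine cross_ext₂ fun f α g β ↦ ?_
    simp only [LinearMap.add_apply, LinearMap.compl₁₂_apply, LinearMap.id_apply,
      LinearMap.zero_apply, standardAction_delta]
    by_cases hαβ : α * β = 1
    · have hμ : muForm β + slashLin β (muForm β⁻¹) = 0 := by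
        rw [add_comm, ← muForm_mul, inv_mul_cancel, muForm_one]
      simp only [tau0_mono_of_mul_eq_one z₀ hαβ, ← map_add]
      convert map_zero (period z₀ (toGLReal α • z₀)) using 2
      rw [← eq_inv_of_mul_eq_one_right hαβ, slashLin_map_mul]
      change muForm β * f * _ + f * (slashLin β (muForm β⁻¹) * _) = 0
      linear_combination f * slashLin β g * hμ
    · simp only [tau0_mono_of_mul_ne_one z₀ hαβ, add_zero]
  exact LinearMap.congr_fun₂ h a₀ a₁

theorem isDeltaInvariant_tau0 (z₀ : ℍ) : IsDeltaInvariant standardAction (tau0 z₀) :=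
  isDeltaInvariant_of_generators (tau0_X_invariant z₀) (tau0_Y_invariant z₀)
    (tau0_delta_invariant z₀)

end ModularSymbol

end

theorem mainTheorem5 (z₀ : UpperHalfPlane) :
    ModularSymbol.IsCyclicOneCocycle (ModularSymbol.tau0 z₀) ∧
      ModularSymbol.IsDeltaInvariant ModularSymbol.standardAction (ModularSymbol.tau0 z₀) :=
  ⟨ModularSymbol.isCyclicOneCocycle_tau0 z₀, ModularSymbol.isDeltaInvariant_tau0 z₀⟩
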